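/- Call a finite simple graph $G=(V,E)$ a unit distance graph in $\mathbb{R}^d$ if there is an injective map $f:V\to\mathbb{R}^d$ such that $|f(u)-f(v)|=1$ (Euclidean distance) for every edge $uv\in E$; non-adjacent vertices are also allowed to be at distance $1$. **Theorem 1.** Let $d\ge 1$ and let $G$ be a finite simple graph with maximum degree $d$. Then $G$ is a unit distance graph in $\mathbb{R}^d$, except if $d=3$ and $G$ contains $K_{3,3}$ as a subgraph, in which case $G$ is not a unit distance graph in $\mathbb{R}^3$. -/

import Mathlib

/-- A graph `G` is (isomorphic to) a unit distance graph in `ℝ^d`: its vertices can be placed at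
pairwise distinct points of Euclidean `d`-space so that the endpoints of every edge are at distance
exactly `1`. Non-adjacent vertices may also be at distance `1`. -/
def IsUnitDistanceGraph {V : Type*} (G : SimpleGraph V) (d : ℕ) : Prop :=
  ∃ f : V → EuclideanSpace ℝ (Fin d),
    Function.Injective f ∧ ∀ u v : V, G.Adj u v → dist (f u) (f v) = 1

/-!
Let `G` have maximum degree `d`. Write `d` as a sum of twos and, if `d` is odd and at least three,
one three, and split `ℝ^d` into orthogonal summands of these dimensions. The vertices are
partitioned into one part for each summand and an exceptional part `X`. A vertex off `X` is placed
in the summand of its part, on the sphere of radius `1 / √2` about the origin. Then vertices of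
different parts are at distance one, and vertices of the same part are at distance one if and only
if their vectors are orthogonal. A vertex `x ∈ X` is placed on a line `ℝ w`, where `w` has the same
inner product with the unit vectors of all neighbours of `x`; it is at distance one from them for
two values of the scalar. This succeeds if the vertices off `X` are at distinct points and no three
vertices of `X` have the same `w` (`isUnitDistanceGraph_of_equations`). For `d = 1`, the graph is a
matching, drawn directly on the line.

The partition is a variant of Lovász's: each part has the dimension of its summand as capacity, `X`
has capacity zero, an energy is minimised, and among the minimisers `X` is chosen as large as
possible (`IsOptimal`). It follows that `X` is independent, that each `x ∈ X` has exactly `k`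
neighbours in each part of dimension `k`, that the degrees inside that part are less than `k`, and
that the degrees of its vertices into the part and into `X` add up to at most `k`. Moreover, an
independent set of vertices of a part cannot be exchanged for a smaller subset of `X` if it becomes
full by that (`IsOptimal.exchange`).

A part of dimension two induces a matching and is placed on a circle. A vector `w` determines the
two neighbours in that part, so three vertices of `X` with the same `w` would have a common
neighbour with too many neighbours in `X` (`exists_isPlacement_circle`).

A part of dimension three induces paths and cycles. One vertex of each cycle, a closer, is set
aside; the remaining paths are placed on the sphere in general position, vertex by vertex, as every
degenerate configuration is a zero of an analytic function on the circle of admissible vectors that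
does not vanish identically (`exists_isGeneric`). A closer is placed orthogonally to its two
neighbours. The exchange property excludes the configurations in which closers are not in general
position. So the three neighbours of `x ∈ X` are linearly independent and `w` exists
(`IsSpherePart.tripleProd_ne_zero`), and three vertices of `X` with the same `w` have the same three
neighbours (`IsSpherePart.adj_of_equation`). The latter is needed only for `d = 3`, where the six
vertices form a `K₃,₃`; for other odd `d ≥ 5` there is a part of dimension two as well.

Conversely, in a unit distance representation of `K₃,₃` in `ℝ³` each side consists of three points
on a sphere, which span a plane, and the two planes have mutually orthogonal directions, which is
impossible in dimension three (`not_isUnitDistanceGraph_of_isContained`).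
-/

/-! ### Degrees into sets and energy-minimal partitions -/

section Partition
open Finset
open scoped Classical

variable {V Q : Type*}

/-- The number of neighbours of `v` in the set `S`. -/
noncomputable def SimpleGraph.degIn (G : SimpleGraph V) (S : Finset V) (v : V) : ℕ :=
  #{w ∈ S | G.Adj v w}

lemma degIn_mono (G : SimpleGraph V) {S T : Finset V} (h : S ⊆ T) (v : V) :
    G.degIn S v ≤ G.degIn T v :=
  card_le_card (filter_subset_filter _ h)

lemma degIn_union (G : SimpleGraph V) {S T : Finset V} (h : Disjoint S T) (v : V) :
    G.degIn (S ∪ T) v = G.degIn S v + G.degIn T v := by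
  unfold SimpleGraph.degIn
  rw [filter_union, card_union_of_disjoint (disjoint_filter_filter h)]

variable {G : SimpleGraph V}

lemma degIn_erase {S : Finset V} {r : V} (hr : r ∈ S) (v : V) :
    G.degIn S v = G.degIn (S.erase r) v + if G.Adj v r then 1 else 0 := by
  unfold SimpleGraph.degIn
  conv_lhs => rw [← insert_erase hr, filter_insert]
  split_ifs
  · rw [card_insert_of_notMem (by simp)]
  · rfl

lemma degIn_singleton_of_adj {x a : V} (h : G.Adj a x) : G.degIn {x} a = 1 := by
  unfold SimpleGraph.degIn
  rw [filter_singleton, if_pos h, card_singleton]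

lemma degIn_eq_sum (S : Finset V) (a : V) : G.degIn S a = ∑ x ∈ S, if G.Adj a x then 1 else 0 := by
  unfold SimpleGraph.degIn
  rw [card_filter]

lemma sum_degIn_comm (S T : Finset V) : ∑ x ∈ S, G.degIn T x = ∑ y ∈ T, G.degIn S y := by
  simp only [degIn_eq_sum]
  rw [sum_comm]
  simp only [G.adj_comm]

lemma degIn_le_card (S : Finset V) (a : V) : G.degIn S a ≤ #S := card_filter_le _ _

lemma degIn_pos_iff {S : Finset V} {a : V} : 0 < G.degIn S a ↔ ∃ x ∈ S, G.Adj a x := by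
  unfold SimpleGraph.degIn
  rw [card_pos, filter_nonempty_iff]

variable [Fintype V]

/-- The part of the partition `s : V → Q` with label `q`. -/
noncomputable def partOf (s : V → Q) (q : Q) : Finset V := {w | s w = q}

@[simp] lemma mem_partOf {s : V → Q} {q : Q} {v : V} : v ∈ partOf s q ↔ s v = q := by
  simp [partOf]

/-- The energy of a partition `s` whose parts have capacities `k`: twice the number of edges inside
the parts, minus twice the sum of the capacities over all vertices. It changes by twice the change
of excess when one vertex is moved, the excess of `v` in a part being its degree into that part
minus the capacity. -/
noncomputable def energy (G : SimpleGraph V) (k : Q → ℕ) (s : V → Q) : ℤ :=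
  ∑ v, (G.degIn (partOf s (s v)) v : ℤ) - 2 * ∑ v, (k (s v) : ℤ)

lemma degIn_partOf_eq (G : SimpleGraph V) (s : V → Q) (q : Q) (v : V) :
    (G.degIn (partOf s q) v : ℤ) = ∑ w, if G.Adj v w ∧ q = s w then 1 else 0 := by
  rw [SimpleGraph.degIn, card_filter, partOf, sum_filter]
  push_cast
  refine sum_congr rfl fun w _ => ?_
  by_cases h1 : s w = q <;> by_cases h2 : G.Adj v w <;> simp [h1, h2]; tauto

lemma degIn_partOf_update (G : SimpleGraph V) (s : V → Q) (v : V) (q q' : Q) :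
    G.degIn (partOf (Function.update s v q) q') v = G.degIn (partOf s q') v := by
  unfold SimpleGraph.degIn
  congr 1
  ext w
  simp only [mem_filter, mem_partOf]
  refine and_congr_left fun h => ?_
  rw [Function.update_of_ne h.ne']

lemma sum_sum_eq_erase (f : V → V → ℤ) (v : V) (hs : ∀ u w, f u w = f w u) (h0 : f v v = 0) :
    ∑ u, ∑ w, f u w = ∑ u ∈ univ.erase v, ∑ w ∈ univ.erase v, f u w + 2 * ∑ w, f v w := by
  rw [← add_sum_erase univ _ (mem_univ v)]
  have : ∀ u, ∑ w, f u w = f u v + ∑ w ∈ univ.erase v, f u w := fun u =>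
    (add_sum_erase univ _ (mem_univ v)).symm
  have h2 : ∑ u ∈ univ.erase v, ∑ w, f u w
      = ∑ u ∈ univ.erase v, f u v + ∑ u ∈ univ.erase v, ∑ w ∈ univ.erase v, f u w := by
    rw [← sum_add_distrib]; exact sum_congr rfl fun u _ => this u
  have h3 : ∑ u ∈ univ.erase v, f u v = ∑ w, f v w := by
    rw [this v, h0, zero_add]; exact sum_congr rfl fun u _ => hs u v
  rw [h2, h3]; ring

/-- Moving `v` to the part `q` changes the energy by twice the difference of the excesses. -/
lemma energy_update (G : SimpleGraph V) (k : Q → ℕ) (s : V → Q) (v : V) (q : Q) :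
    energy G k (Function.update s v q) = energy G k s +
      2 * (((G.degIn (partOf s q) v : ℤ) - k q) - ((G.degIn (partOf s (s v)) v : ℤ) - k (s v))) := by
  have key : ∀ t : V → Q, ∑ u, (G.degIn (partOf t (t u)) u : ℤ) =
      ∑ u ∈ univ.erase v, ∑ w ∈ univ.erase v, (if G.Adj u w ∧ t u = t w then 1 else 0) +
        2 * (G.degIn (partOf t (t v)) v : ℤ) := by
    intro t
    simp_rw [degIn_partOf_eq]
    rw [sum_sum_eq_erase _ v (fun u w => by simp [G.adj_comm, eq_comm]) (by simp)]
  have hk : ∑ u, (k (Function.update s v q u) : ℤ) = ∑ u, (k (s u) : ℤ) + k q - k (s v) := by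
    rw [← add_sum_erase univ _ (mem_univ v),
      ← add_sum_erase univ (fun u => (k (s u) : ℤ)) (mem_univ v)]
    rw [Function.update_self, sum_congr rfl (g := fun u => (k (s u) : ℤ))]
    · ring
    · intro u hu
      rw [Function.update_of_ne (ne_of_mem_erase hu)]
  have hJ : ∑ u ∈ univ.erase v, ∑ w ∈ univ.erase v,
      (if G.Adj u w ∧ Function.update s v q u = Function.update s v q w then (1 : ℤ) else 0) =
      ∑ u ∈ univ.erase v, ∑ w ∈ univ.erase v, (if G.Adj u w ∧ s u = s w then 1 else 0) := by
    refine sum_congr rfl fun u hu => sum_congr rfl fun w hw => ?_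
    rw [Function.update_of_ne (ne_of_mem_erase hu), Function.update_of_ne (ne_of_mem_erase hw)]
  unfold energy
  rw [key, key s, hk, hJ, Function.update_self, degIn_partOf_update]
  ring

/-- `s` minimises the energy. -/
def IsMinimal (G : SimpleGraph V) (k : Q → ℕ) (s : V → Q) : Prop :=
  ∀ t : V → Q, energy G k s ≤ energy G k t

variable {k : Q → ℕ} {s : V → Q}

/-- Every vertex has its least excess in its own part. -/
lemma IsMinimal.excess_le (h : IsMinimal G k s) (v : V) (q : Q) :
    (G.degIn (partOf s (s v)) v : ℤ) - k (s v) ≤ (G.degIn (partOf s q) v : ℤ) - k q := by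
  have := h (Function.update s v q)
  rw [energy_update] at this
  linarith

lemma sum_degIn_partOf [Fintype Q] (G : SimpleGraph V) (s : V → Q) (v : V) :
    ∑ q, G.degIn (partOf s q) v = G.degIn univ v := by
  unfold SimpleGraph.degIn
  rw [card_eq_sum_card_fiberwise (f := s) (t := univ) (by simp)]
  refine sum_congr rfl fun q _ => ?_
  congr 1
  ext w
  simp [and_comm]

/-- A vertex of nonnegative excess in its own part has excess zero everywhere, because the excesses
sum to at most zero. -/
lemma IsMinimal.full [Fintype Q] (h : IsMinimal G k s)
    (hd : ∀ v, G.degIn univ v ≤ ∑ q, k q) {v : V} (hv : k (s v) ≤ G.degIn (partOf s (s v)) v)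
    (q : Q) : G.degIn (partOf s q) v = k q := by
  have h1 : ∀ q ∈ univ, k q ≤ G.degIn (partOf s q) v := fun q _ => by
    have := h.excess_le v q
    zify at hv ⊢
    linarith
  have h2 := sum_degIn_partOf G s v
  have h3 : ∑ q, k q = ∑ q, G.degIn (partOf s q) v :=
    le_antisymm (sum_le_sum h1) (h2 ▸ hd v)
  exact ((sum_eq_sum_iff_of_le h1).1 h3 q (mem_univ q)).symm

/-- Moving a vertex of nonnegative excess keeps the energy minimal. -/
lemma IsMinimal.update [Fintype Q] (h : IsMinimal G k s)
    (hd : ∀ v, G.degIn univ v ≤ ∑ q, k q) {v : V} (hv : k (s v) ≤ G.degIn (partOf s (s v)) v)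
    (q : Q) : IsMinimal G k (Function.update s v q) := by
  intro t
  rw [energy_update, h.full hd hv q, h.full hd hv (s v)]
  simpa using h t

end Partition

/-! ### Optimal partitions and the exchange property -/

section Exchange
open Finset
open scoped Classical

variable {V ι : Type*} [Fintype V] [Fintype ι] {G : SimpleGraph V} {k : Option ι → ℕ}
  {s : V → Option ι}

/-- Vertices of the part `none`, whose capacity is zero, may be moved freely. -/
lemma IsMinimal.move_set (h : IsMinimal G k s) (hk : k none = 0)
    (hd : ∀ v, G.degIn univ v ≤ ∑ q, k q) (D : Finset V) (hD : ∀ v ∈ D, s v = none) (q : Option ι) :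
    IsMinimal G k (fun v => if v ∈ D then q else s v) := by
  induction D using Finset.induction_on with
  | empty => simpa using h
  | insert a D ha ih =>
    have h1 := ih fun v hv => hD v (mem_insert_of_mem hv)
    have h2 := h1.update hd (v := a) (by simp [ha, hD a (mem_insert_self _ _), hk]) q
    convert h2 using 1
    ext1 v
    by_cases hv : v = a
    · subst hv; simp
    · simp [hv]

/-- Vertices of a part `q` that are full there may be moved to the part `none`. -/
lemma IsMinimal.move_full (h : IsMinimal G k s)
    (hd : ∀ v, G.degIn univ v ≤ ∑ q, k q) (q : Option ι) (A : Finset V) (hA : ∀ v ∈ A, s v = q)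
    (hind : ∀ u ∈ A, ∀ v ∈ A, ¬ G.Adj u v) (hfull : ∀ v ∈ A, k q ≤ G.degIn (partOf s q) v) :
    IsMinimal G k (fun v => if v ∈ A then none else s v) := by
  induction A using Finset.induction_on with
  | empty => simpa using h
  | insert a A ha ih =>
    have h1 := ih (fun v hv => hA v (mem_insert_of_mem hv))
      (fun u hu v hv => hind u (mem_insert_of_mem hu) v (mem_insert_of_mem hv))
      (fun v hv => hfull v (mem_insert_of_mem hv))
    have h2 := h1.update hd (v := a) (by
      have e : (if a ∈ A then none else s a) = q := by
        rw [if_neg ha]; exact hA a (mem_insert_self _ _)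
      rw [e]
      refine (hfull a (mem_insert_self _ _)).trans (card_le_card fun w hw => ?_)
      simp only [mem_filter, mem_partOf] at hw ⊢
      refine ⟨?_, hw.2⟩
      rw [if_neg, hw.1]
      exact fun hwA => hind a (mem_insert_self _ _) w (mem_insert_of_mem hwA) hw.2) none
    convert h2 using 1
    ext1 v
    by_cases hv : v = a
    · subst hv; simp
    · simp [hv]

/-- An energy-minimal partition with parts indexed by `ι` and an exceptional part `none`, in which
the part `none` is as large as possible. -/
structure IsOptimal (G : SimpleGraph V) (k : Option ι → ℕ) (s : V → Option ι) : Prop where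
  minimal : IsMinimal G k s
  card_le : ∀ t, IsMinimal G k t → #(partOf t none) ≤ #(partOf s none)

lemma exists_isOptimal (G : SimpleGraph V) (k : Option ι → ℕ) : ∃ s, IsOptimal G k s := by
  obtain ⟨s₀, -, h₀⟩ := exists_min_image (univ : Finset (V → Option ι)) (energy G k)
    ⟨fun _ => none, mem_univ _⟩
  obtain ⟨s, hs, h⟩ := exists_max_image ({s | IsMinimal G k s} : Finset (V → Option ι))
    (fun s => #(partOf s none))
    ⟨s₀, by simp only [mem_filter, mem_univ, true_and]; exact fun t => h₀ t (mem_univ t)⟩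
  exact ⟨s, by simpa using hs, fun t ht => h t (by simpa using ht)⟩

namespace IsOptimal

/-- Exchanging `D`, taken from `none`, for an independent set `A` that becomes full in part `j`
keeps the energy minimal and hence cannot enlarge the part `none`. -/
lemma exchange (h : IsOptimal G k s) (hk : k none = 0) (hd : ∀ v, G.degIn univ v ≤ ∑ q, k q)
    (j : ι) (D A : Finset V) (hD : ∀ v ∈ D, s v = none) (hA : ∀ v ∈ A, s v = some j)
    (hind : ∀ u ∈ A, ∀ v ∈ A, ¬ G.Adj u v)
    (hfull : ∀ v ∈ A, k (some j) ≤ G.degIn (partOf s (some j) ∪ D) v) : #A ≤ #D := by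
  have h1 := h.minimal.move_set hk hd D hD (some j)
  have hAD : ∀ v ∈ A, v ∉ D := fun v hv hv' => absurd (hD v hv') (by simp [hA v hv])
  have hp : partOf (fun v => if v ∈ D then some j else s v) (some j) = partOf s (some j) ∪ D := by
    ext v
    by_cases hv : v ∈ D <;> simp [hv]
  have h2 := h1.move_full hd (some j) A (fun v hv => by simp [hAD v hv, hA v hv]) hind (by rwa [hp])
  have h3 := h.card_le _ h2
  have h4 : partOf (fun v => if v ∈ A then none else if v ∈ D then some j else s v) none
      = A ∪ (partOf s none \ D) := by
    ext v
    by_cases hv : v ∈ A <;> by_cases hv' : v ∈ D <;> simp [hv, hv']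
  rw [h4, card_union_of_disjoint, card_sdiff_of_subset] at h3
  · have : #D ≤ #(partOf s none) := card_le_card fun v hv => by simpa using hD v hv
    omega
  · intro v hv; simpa using hD v hv
  · rw [disjoint_left]
    intro v hv hv'
    simp [hA v hv] at hv'

/-- Vertices of the exceptional part have full degree into every part. -/
lemma degIn_none (h : IsOptimal G k s) (hk : k none = 0) (hd : ∀ v, G.degIn univ v ≤ ∑ q, k q)
    {x : V} (hx : s x = none) (q : Option ι) : G.degIn (partOf s q) x = k q :=
  h.minimal.full hd (by simp [hx, hk]) q

lemma degIn_lt (h : IsOptimal G k s) (hk : k none = 0) (hd : ∀ v, G.degIn univ v ≤ ∑ q, k q)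
    {v : V} {j : ι} (hv : s v = some j) : G.degIn (partOf s (some j)) v < k (some j) := by
  by_contra! hc
  have := h.exchange hk hd j ∅ {v} (by simp) (by simpa using hv) (by simp) (by simpa using hc)
  simp at this

/-- Otherwise all but one of the neighbours of `v` in `none` could be moved to the part of `v`,
which makes `v` full there although it still has a neighbour in `none`. -/
lemma degIn_add_le (h : IsOptimal G k s) (hk : k none = 0) (hd : ∀ v, G.degIn univ v ≤ ∑ q, k q)
    {v : V} {j : ι} (hv : s v = some j) :
    G.degIn (partOf s (some j)) v + G.degIn (partOf s none) v ≤ k (some j) := by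
  by_contra! hc
  have hlt := h.degIn_lt hk hd hv
  obtain ⟨x, hx⟩ : ({w ∈ partOf s none | G.Adj v w}).Nonempty := by
    rw [← card_pos]; unfold SimpleGraph.degIn at *; omega
  -- move all neighbours of `v` in `none` but `x` to the part of `v`
  set D := ({w ∈ partOf s none | G.Adj v w}).erase x with hD
  have hDc : #D + 1 = G.degIn (partOf s none) v := card_erase_add_one hx
  have h1 := h.minimal.move_set hk hd D (fun w hw => by
    have := mem_of_mem_erase hw; simp at this; exact this.1) (some j)
  have hvD : v ∉ D := fun hc => by have := mem_of_mem_erase hc; simp at this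
  have hp : partOf (fun v => if v ∈ D then some j else s v) (some j) = partOf s (some j) ∪ D := by
    ext v
    by_cases hv : v ∈ D <;> simp [hv]
  have h2 := h1.full hd (v := v) (by
    simp only [if_neg hvD, hv, hp]
    rw [degIn_union]
    · have : G.degIn D v = #D := by
        unfold SimpleGraph.degIn
        rw [filter_true_of_mem]
        intro w hw
        exact (mem_filter.1 (mem_of_mem_erase hw)).2
      omega
    · rw [disjoint_left]
      intro w hw hw'
      have := mem_of_mem_erase hw'
      simp at this hw
      simp [hw] at this) none
  rw [hk] at h2
  have : x ∈ ({w ∈ partOf (fun v => if v ∈ D then some j else s v) none | G.Adj v w} :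
      Finset V) := by
    simp only [mem_filter, mem_partOf] at hx ⊢
    simp [hD, hx]
  unfold SimpleGraph.degIn at h2
  rw [card_eq_zero] at h2
  simp [h2] at this

end IsOptimal
end Exchange

/-! ### Drawing a matching on the line -/

section Matching
open Finset
open scoped Classical

/-- A matching can be drawn on the line with edges of length one, inside `[0, 2)`. -/
lemma exists_matching_line {V : Type*} [Fintype V] (G : SimpleGraph V) (S : Finset V)
    (hS : ∀ v ∈ S, G.degIn S v ≤ 1) :
    ∃ τ : V → ℝ, (∀ v ∈ S, 0 ≤ τ v ∧ τ v < 2) ∧ Set.InjOn τ S ∧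
      ∀ u ∈ S, ∀ v ∈ S, G.Adj u v → τ u = τ v + 1 ∨ τ v = τ u + 1 := by
  have huniq : ∀ u ∈ S, ∀ v ∈ S, ∀ w ∈ S, G.Adj u v → G.Adj u w → v = w := by
    intro u hu v hv w hw h1 h2
    exact card_le_one.1 (hS u hu) v (by simp [hv, h1]) w (by simp [hw, h2])
  obtain ⟨b, hb, hb0, hb1⟩ : ∃ b : V → ℝ, Function.Injective b ∧ (∀ v, 0 ≤ b v) ∧ ∀ v, b v < 1 := by
    refine ⟨fun v => (Fintype.equivFin V v : ℕ) / (Fintype.card V : ℝ), ?_,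
      fun v => by positivity, ?_⟩
    · intro u v h
      have hc : (Fintype.card V : ℝ) ≠ 0 := by
        have := Fintype.card_pos_iff.2 ⟨u⟩
        positivity
      have h' := (div_left_inj' hc).1 h
      exact (Fintype.equivFin V).injective (Fin.ext (by exact_mod_cast h'))
    · intro v
      have := Fintype.card_pos_iff.2 ⟨v⟩
      rw [div_lt_one (by positivity)]
      exact_mod_cast (Fintype.equivFin V v).2
  -- the later endpoint of an edge is placed one unit to the right of the earlier one
  let P : V → V → Prop := fun u v => v ∈ S ∧ G.Adj u v ∧ b v < b u
  let τ : V → ℝ := fun u => if h : ∃ v, P u v then b h.choose + 1 else b u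
  have hτ1 : ∀ u v, u ∈ S → P u v → τ u = b v + 1 := by
    intro u v hu hv
    have h : ∃ v, P u v := ⟨v, hv⟩
    simp only [τ, dif_pos h]
    rw [huniq u hu _ h.choose_spec.1 v hv.1 h.choose_spec.2.1 hv.2.1]
  have hτ2 : ∀ u, (¬ ∃ v, P u v) → τ u = b u := fun u h => by simp only [τ, dif_neg h]
  refine ⟨τ, ?_, ?_, ?_⟩
  · intro v hv
    by_cases h : ∃ w, P v w
    · obtain ⟨w, hw⟩ := h
      rw [hτ1 v w hv hw]
      constructor <;> linarith [hb0 w, hb1 w]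
    · rw [hτ2 v h]
      constructor <;> linarith [hb0 v, hb1 v]
  · intro u hu v hv huv
    by_cases h : ∃ w, P u w <;> by_cases h' : ∃ w, P v w
    · obtain ⟨w, hw⟩ := h
      obtain ⟨w', hw'⟩ := h'
      rw [hτ1 u w hu hw, hτ1 v w' hv hw'] at huv
      have : w = w' := hb (by linarith)
      subst this
      exact huniq w hw.1 u hu v hv hw.2.1.symm hw'.2.1.symm
    · obtain ⟨w, hw⟩ := h
      rw [hτ1 u w hu hw, hτ2 v h'] at huv
      linarith [hb0 w, hb1 v]
    · obtain ⟨w', hw'⟩ := h'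
      rw [hτ2 u h, hτ1 v w' hv hw'] at huv
      linarith [hb0 w', hb1 u]
    · rw [hτ2 u h, hτ2 v h'] at huv
      exact hb huv
  · have key : ∀ u ∈ S, ∀ v ∈ S, G.Adj u v → b v < b u → τ u = τ v + 1 := by
      intro u hu v hv huv hlt
      rw [hτ1 u v hu ⟨hv, huv, hlt⟩, hτ2 v]
      rintro ⟨w, hw, hvw, hlt'⟩
      rw [huniq v hv w hw u hu hvw huv.symm] at hlt'
      exact lt_asymm hlt hlt'
    intro u hu v hv huv
    rcases lt_trichotomy (b v) (b u) with h | h | h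
    · exact Or.inl (key u hu v hv huv h)
    · exact absurd (hb h).symm huv.ne
    · exact Or.inr (key v hv u hu huv.symm h)

end Matching

/-! ### Unit distance graphs from orthogonal representations -/

section Assembly
open Finset
open scoped Classical RealInnerProductSpace

variable {V : Type*} [Fintype V] {G : SimpleGraph V} {E : Type*} [NormedAddCommGroup E]
  [InnerProductSpace ℝ E]

/-- A map all of whose fibres have at most two elements becomes injective together with a suitable
Boolean label. -/
lemma exists_injective_pair {α β : Type*} [Finite α] (w : α → β)
    (hw : ∀ x y z, w x = w y → w y = w z → x = y ∨ y = z ∨ x = z) :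
    ∃ ε : α → Bool, ∀ x y, w x = w y → ε x = ε y → x = y := by
  have := Fintype.ofFinite α
  have h : ∀ b : β, ∃ e : α → Bool, ∀ x y, w x = b → w y = b → e x = e y → x = y := by
    intro b
    have : Nonempty ({x // w x = b} ↪ Bool) := by
      rw [Function.Embedding.nonempty_iff_card_le]
      by_contra! hc
      rw [Fintype.card_bool, Fintype.two_lt_card_iff] at hc
      obtain ⟨x, y, z, hxy, hxz, hyz⟩ := hc
      rcases hw x y z (x.2.trans y.2.symm) (y.2.trans z.2.symm) with h | h | h
      · exact hxy (Subtype.ext h)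
      · exact hyz (Subtype.ext h)
      · exact hxz (Subtype.ext h)
    obtain ⟨e⟩ := this
    refine ⟨fun x => if h : w x = b then e ⟨x, h⟩ else false, fun x y hx hy h => ?_⟩
    simpa [hx, hy] using h
  choose e he using h
  exact ⟨fun x => e (w x) x, fun x y hxy h => he (w x) x y rfl hxy.symm (by simpa [← hxy] using h)⟩

/-- Vertices off the independent set `X` are placed at `g v / √2`, so that orthogonality means
distance one. A vertex `x` of `X` is placed at a multiple `t • w x`; being at distance one from its
neighbours is then the single equation `t ^ 2 * ‖w x‖ ^ 2 - √2 * t = 1 / 2`, whose two roots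
separate two vertices with the same `w`. -/
lemma isUnitDistanceGraph_of_equations [FiniteDimensional ℝ E] {d : ℕ}
    (hd : Module.finrank ℝ E = d) (X : Finset V) (g w : V → E)
    (hg1 : ∀ v ∉ X, ‖g v‖ = 1) (hginj : ∀ u ∉ X, ∀ v ∉ X, g u = g v → u = v)
    (hgadj : ∀ u ∉ X, ∀ v ∉ X, G.Adj u v → ⟪g u, g v⟫ = 0)
    (hX : ∀ u ∈ X, ∀ v ∈ X, ¬ G.Adj u v) (hw0 : ∀ x ∈ X, w x ≠ 0)
    (hw : ∀ x ∈ X, ∀ v ∉ X, G.Adj x v → ⟪w x, g v⟫ = 1)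
    (hfib : ∀ x ∈ X, ∀ y ∈ X, ∀ z ∈ X, w x = w y → w y = w z → x = y ∨ y = z ∨ x = z) :
    IsUnitDistanceGraph G d := by
  obtain ⟨ε, hε⟩ := exists_injective_pair (fun x : X => w x)
    (fun x y z h1 h2 => by
      exact (hfib x x.2 y y.2 z z.2 h1 h2).imp Subtype.ext (Or.imp Subtype.ext Subtype.ext))
  -- the two roots of `t ^ 2 * n - √2 * t = 1 / 2`
  have hroot : ∀ n : ℝ, 0 < n → ∃ t : Bool → ℝ, t true ≠ t false ∧
      ∀ b, t b ^ 2 * n - √2 * t b = 1 / 2 := by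
    intro n hn
    have hs : √2 ^ 2 = 2 := Real.sq_sqrt (by norm_num)
    have hD : √(2 + 2 * n) ^ 2 = 2 + 2 * n := Real.sq_sqrt (by positivity)
    have hDp : 0 < √(2 + 2 * n) := by positivity
    refine ⟨fun b => if b then (√2 + √(2 + 2 * n)) / (2 * n) else (√2 - √(2 + 2 * n)) / (2 * n), ?_, ?_⟩
    · simp only [if_true, Bool.false_eq_true, if_false]
      rw [Ne, div_left_inj' (by positivity)]
      intro h
      linarith
    · intro b
      have h1 : (√(2 + 2 * n) ^ 2 - √2 ^ 2) / (4 * n) = 1 / 2 := by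
        rw [hD, hs]; field_simp; ring
      rw [← h1]
      cases b <;> simp only [if_true, Bool.false_eq_true, if_false] <;>
        generalize √(2 + 2 * n) = r <;> generalize √2 = s <;> field_simp <;> ring
  choose! t ht1 ht2 using hroot
  let f : V → E := fun v => if h : v ∈ X then t (‖w v‖ ^ 2) (ε ⟨v, h⟩) • w v else (√2)⁻¹ • g v
  have hs : √2 ^ 2 = 2 := Real.sq_sqrt (by norm_num)
  have hs0 : √2 ≠ 0 := by positivity
  have hn : ∀ x ∈ X, 0 < ‖w x‖ ^ 2 := fun x hx => by
    have := norm_pos_iff.2 (hw0 x hx); positivity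
  have hfX : ∀ x (hx : x ∈ X), ‖f x‖ ^ 2 = 1 / 2 + √2 * t (‖w x‖ ^ 2) (ε ⟨x, hx⟩) := by
    intro x hx
    simp only [f, dif_pos hx, norm_smul, mul_pow, Real.norm_eq_abs, sq_abs]
    linarith [ht2 _ (hn x hx) (ε ⟨x, hx⟩)]
  have ht0 : ∀ x (hx : x ∈ X), t (‖w x‖ ^ 2) (ε ⟨x, hx⟩) ≠ 0 := by
    intro x hx h0
    have := ht2 _ (hn x hx) (ε ⟨x, hx⟩)
    rw [h0] at this
    norm_num at this
  have hfg : ∀ v ∉ X, f v = (√2)⁻¹ • g v := fun v hv => by simp only [f, dif_neg hv]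
  have hfgn : ∀ v ∉ X, ‖f v‖ ^ 2 = 1 / 2 := fun v hv => by
    rw [hfg v hv, norm_smul, hg1 v hv]
    simp [hs]
  have hinj : Function.Injective f := by
    intro u v huv
    by_cases hu : u ∈ X <;> by_cases hv : v ∈ X
    · have h1 := hfX u hu
      rw [huv, hfX v hv] at h1
      have h2 : t (‖w u‖ ^ 2) (ε ⟨u, hu⟩) = t (‖w v‖ ^ 2) (ε ⟨v, hv⟩) := by
        have := mul_left_cancel₀ hs0 (add_left_cancel h1); exact this.symm
      have h3 : w u = w v := by
        simp only [f, dif_pos hu, dif_pos hv] at huv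
        rw [h2] at huv
        exact smul_right_injective E (ht0 v hv) huv
      have h4 : ε ⟨u, hu⟩ = ε ⟨v, hv⟩ := by
        rw [h3] at h2
        have h5 := ht1 _ (hn v hv)
        revert h2
        cases ε ⟨u, hu⟩ <;> cases ε ⟨v, hv⟩ <;> simp [h5, h5.symm]
      simpa using hε ⟨u, hu⟩ ⟨v, hv⟩ h3 h4
    · have h1 := hfX u hu
      rw [huv, hfgn v hv] at h1
      have := ht0 u hu
      simp [this] at h1
    · have h1 := hfX v hv
      rw [← huv, hfgn u hu] at h1
      have := ht0 v hv
      simp [this] at h1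
    · rw [hfg u hu, hfg v hv] at huv
      exact hginj u hu v hv (smul_right_injective E (inv_ne_zero hs0) huv)
  have hdist0 : ∀ u v, ‖f u‖ ^ 2 + ‖f v‖ ^ 2 - 2 * ⟪f u, f v⟫ = 1 → ‖f u - f v‖ = 1 := by
    intro u v h
    have h1 := norm_sub_sq_real (f u) (f v)
    have h2 : ‖f u - f v‖ ^ 2 = 1 := by linarith
    have := norm_nonneg (f u - f v)
    nlinarith
  have hmix : ∀ u ∈ X, ∀ v ∉ X, G.Adj u v → ‖f u - f v‖ = 1 := by
    intro u hu v hv huv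
    apply hdist0
    rw [hfX u hu, hfgn v hv, hfg v hv]
    simp only [f, dif_pos hu, inner_smul_left, inner_smul_right, hw u hu v hv huv]
    have : (√2)⁻¹ = √2 / 2 := by field_simp; rw [hs]
    rw [this]
    simp
    ring
  have hdist : ∀ u v, G.Adj u v → ‖f u - f v‖ = 1 := by
    intro u v huv
    by_cases hu : u ∈ X <;> by_cases hv : v ∈ X
    · exact absurd huv (hX u hu v hv)
    · exact hmix u hu v hv huv
    · rw [norm_sub_rev]; exact hmix v hv u hu huv.symm
    · apply hdist0
      rw [hfgn u hu, hfgn v hv, hfg u hu, hfg v hv, inner_smul_left, inner_smul_right,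
        hgadj u hu v hv huv]
      norm_num
  let Φ := (stdOrthonormalBasis ℝ E).reindex (finCongr hd)
  refine ⟨fun v => Φ.repr (f v), Φ.repr.injective.comp hinj, fun u v huv => ?_⟩
  rw [LinearIsometryEquiv.dist_map, dist_eq_norm]
  exact hdist u v huv

end Assembly

/-! ### Vectors in space -/

section Vectors
open Matrix Filter Topology
open scoped ContDiff

/-- The normal vector `a × b + b × c + c × a` of the plane through `a`, `b`, `c`. -/
def planeNormal (a b c : Fin 3 → ℝ) : Fin 3 → ℝ := a ⨯₃ b + b ⨯₃ c + c ⨯₃ a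

/-- The determinant of three vectors. -/
def tripleProd (a b c : Fin 3 → ℝ) : ℝ := a ⬝ᵥ b ⨯₃ c

lemma dot3 (a b : Fin 3 → ℝ) : a ⬝ᵥ b = a 0 * b 0 + a 1 * b 1 + a 2 * b 2 := by
  simp [dotProduct, Fin.sum_univ_three]

lemma cross0 (a b : Fin 3 → ℝ) : (a ⨯₃ b) 0 = a 1 * b 2 - a 2 * b 1 := rfl
lemma cross1 (a b : Fin 3 → ℝ) : (a ⨯₃ b) 1 = a 2 * b 0 - a 0 * b 2 := rfl
lemma cross2 (a b : Fin 3 → ℝ) : (a ⨯₃ b) 2 = a 0 * b 1 - a 1 * b 0 := rfl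

lemma planeNormal_rot (a b c : Fin 3 → ℝ) : planeNormal b c a = planeNormal a b c := by
  unfold planeNormal; abel

lemma tripleProd_rot (a b c : Fin 3 → ℝ) : tripleProd b c a = tripleProd a b c :=
  (triple_product_permutation a b c).symm

lemma planeNormal_dot (a b c : Fin 3 → ℝ) : a ⬝ᵥ planeNormal a b c = tripleProd a b c := by
  simp only [planeNormal, tripleProd, dot3, Pi.add_apply, cross0, cross1, cross2]; ring

lemma dot_self_eq_zero3 {a : Fin 3 → ℝ} (h : a ⬝ᵥ a = 0) : a = 0 := dotProduct_self_eq_zero.1 h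

lemma dot_self_pos3 {a : Fin 3 → ℝ} (h : a ≠ 0) : 0 < a ⬝ᵥ a := by
  have h0 : 0 ≤ a ⬝ᵥ a := by
    rw [dot3]; nlinarith [sq_nonneg (a 0), sq_nonneg (a 1), sq_nonneg (a 2)]
  rcases lt_or_eq_of_le h0 with h' | h'
  · exact h'
  · exact absurd (dot_self_eq_zero3 h'.symm) h

/-- Two unit vectors that are not parallel are linearly independent. -/
lemma eq_zero_of_smul_eq_smul {y z : Fin 3 → ℝ} (hy : y ⬝ᵥ y = 1) (hz : z ⬝ᵥ z = 1)
    (hyz : (y ⬝ᵥ z) ^ 2 ≠ 1) {α β : ℝ} (h : α • y = β • z) : α = 0 := by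
  have h1 := congrArg (fun t => y ⬝ᵥ t) h
  have h2 := congrArg (fun t => t ⬝ᵥ z) h
  simp only [dotProduct_smul, smul_dotProduct, smul_eq_mul, hy, hz] at h1 h2
  have h3 : α * (1 - (y ⬝ᵥ z) ^ 2) = 0 := by linear_combination h1 - (y ⬝ᵥ z) * h2
  rcases mul_eq_zero.1 h3 with h3 | h3
  · exact h3
  · exact absurd (by linarith) hyz

/-- A vector parallel to the unit vector `b` is its own projection. -/
lemma eq_smul_of_cross_eq_zero {b K : Fin 3 → ℝ} (hb : b ⬝ᵥ b = 1) (h : b ⨯₃ K = 0) :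
    K = (b ⬝ᵥ K) • b := by
  have h1 := cross_cross_eq_smul_sub_smul' b b K
  rw [h, map_zero, hb, one_smul] at h1
  exact (sub_eq_zero.1 h1.symm).symm

lemma exists_smul_unit {a : Fin 3 → ℝ} (h : a ≠ 0) :
    ∃ r : ℝ, r ≠ 0 ∧ (r • a) ⬝ᵥ (r • a) = 1 := by
  have h0 := dot_self_pos3 h
  refine ⟨(√(a ⬝ᵥ a))⁻¹, by positivity, ?_⟩
  have : √(a ⬝ᵥ a) ^ 2 = a ⬝ᵥ a := Real.sq_sqrt h0.le
  rw [smul_dotProduct, dotProduct_smul, smul_eq_mul, smul_eq_mul]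
  field_simp
  exact this.symm

lemma exists_perp_unit (b : Fin 3 → ℝ) : ∃ u : Fin 3 → ℝ, u ⬝ᵥ u = 1 ∧ b ⬝ᵥ u = 0 := by
  obtain ⟨a, ha, hb⟩ : ∃ a : Fin 3 → ℝ, a ≠ 0 ∧ b ⬝ᵥ a = 0 := by
    by_cases h : b 0 = 0
    · exact ⟨![1, 0, 0], fun h' => by simpa using congrFun h' 0, by rw [dot3]; simp [h]⟩
    · exact ⟨![-b 1, b 0, 0], fun h' => h (by simpa using congrFun h' 1), by rw [dot3]; simp; ring⟩
  obtain ⟨r, hr, h⟩ := exists_smul_unit ha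
  exact ⟨r • a, h, by rw [dotProduct_smul, hb, smul_zero]⟩

lemma exists_perp_perp_unit {b : Fin 3 → ℝ} (hb : b ⬝ᵥ b = 1) (K : Fin 3 → ℝ) :
    ∃ u : Fin 3 → ℝ, u ⬝ᵥ u = 1 ∧ b ⬝ᵥ u = 0 ∧ u ⬝ᵥ K = 0 := by
  by_cases h : b ⨯₃ K = 0
  · obtain ⟨u, h1, h2⟩ := exists_perp_unit b
    refine ⟨u, h1, h2, ?_⟩
    rw [eq_smul_of_cross_eq_zero hb h, dotProduct_smul, dotProduct_comm u, h2, smul_zero]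
  · obtain ⟨r, hr, h'⟩ := exists_smul_unit h
    exact ⟨_, h', by simp, by rw [dotProduct_comm, dotProduct_smul, dot_cross_self, smul_zero]⟩

lemma exists_perp_not_perp_unit {b K : Fin 3 → ℝ} (hb : b ⬝ᵥ b = 1) (h : b ⨯₃ K ≠ 0) :
    ∃ u : Fin 3 → ℝ, u ⬝ᵥ u = 1 ∧ b ⬝ᵥ u = 0 ∧ u ⬝ᵥ K ≠ 0 := by
  have h0 : K - (b ⬝ᵥ K) • b ≠ 0 := fun h0 => h (by
    rw [sub_eq_zero.1 h0, map_smul, cross_self, smul_zero])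
  obtain ⟨r, hr, h'⟩ := exists_smul_unit h0
  have hperp : b ⬝ᵥ (K - (b ⬝ᵥ K) • b) = 0 := by
    rw [dotProduct_sub, dotProduct_smul, hb]; simp
  refine ⟨_, h', by rw [dotProduct_smul, hperp, smul_zero], ?_⟩
  have h1 : (K - (b ⬝ᵥ K) • b) ⬝ᵥ K = (K - (b ⬝ᵥ K) • b) ⬝ᵥ (K - (b ⬝ᵥ K) • b) := by
    conv_rhs =>
      rw [dotProduct_sub, dotProduct_smul, dotProduct_comm _ b, hperp, smul_zero, sub_zero]
  rw [smul_dotProduct, h1]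
  exact mul_ne_zero hr (dot_self_pos3 h0).ne'

/-- An analytic function on the line that is not identically zero has no zeros in a punctured
neighbourhood of the origin. Finitely many such functions are thus nonzero at a common point. -/
lemma eventually_ne_zero_of_analytic {F : ℝ → ℝ} (hF : ContDiff ℝ ω F) (h : ∃ θ, F θ ≠ 0) :
    ∀ᶠ θ in 𝓝[≠] 0, F θ ≠ 0 := by
  obtain ⟨θ, hθ⟩ := h
  have hA : AnalyticOnNhd ℝ F Set.univ := hF.analyticOnNhd
  by_contra hc
  have := hA.eqOn_zero_of_preconnected_of_frequently_eq_zero isPreconnected_univ (Set.mem_univ 0)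
    hc
  exact hθ (this (Set.mem_univ θ))

/-- Finitely many planes through the origin do not cover the sphere: the moment curve
`(1, t, t ^ 2)` leaves each of them. -/
lemma exists_unit_dot_ne_zero {ι : Type*} [Finite ι] (K : ι → Fin 3 → ℝ) (hK : ∀ i, K i ≠ 0) :
    ∃ b : Fin 3 → ℝ, b ⬝ᵥ b = 1 ∧ ∀ i, b ⬝ᵥ K i ≠ 0 := by
  have hev : ∀ᶠ t : ℝ in 𝓝[≠] 0, ∀ i, K i 0 + t * K i 1 + t ^ 2 * K i 2 ≠ 0 := by
    refine eventually_all.2 fun i => ?_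
    refine eventually_ne_zero_of_analytic (by fun_prop) ?_
    by_contra! hc
    have h0 := hc 0
    have h1 := hc 1
    have h2 := hc (-1)
    refine hK i (funext fun l => ?_)
    fin_cases l <;> simp <;> linarith
  obtain ⟨t, ht⟩ := hev.exists
  have h0 : (![1, t, t ^ 2] : Fin 3 → ℝ) ≠ 0 := fun h => by simpa using congrFun h 0
  obtain ⟨r, hr, h⟩ := exists_smul_unit h0
  refine ⟨_, h, fun i => ?_⟩
  rw [smul_dotProduct]
  refine mul_ne_zero hr ?_
  have := ht i
  rw [dot3]
  simpa using this

/-- An analytic parametrisation of the great circle orthogonal to `b`. -/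
lemma exists_circle_param {b : Fin 3 → ℝ} (hb : b ⬝ᵥ b = 1) : ∃ c : ℝ → Fin 3 → ℝ,
    ContDiff ℝ ω c ∧ (∀ θ, c θ ⬝ᵥ c θ = 1 ∧ b ⬝ᵥ c θ = 0) ∧
    ∀ u : Fin 3 → ℝ, u ⬝ᵥ u = 1 → b ⬝ᵥ u = 0 → ∃ θ, c θ = u := by
  obtain ⟨e, he, hbe⟩ := exists_perp_unit b
  have hf : (b ⨯₃ e) ⬝ᵥ (b ⨯₃ e) = 1 := by
    rw [cross_dot_cross, hb, he, hbe]; ring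
  have hef : e ⬝ᵥ (b ⨯₃ e) = 0 := dot_cross_self b e
  have hbf : b ⬝ᵥ (b ⨯₃ e) = 0 := dot_self_cross b e
  refine ⟨fun θ => Real.cos θ • e + Real.sin θ • b ⨯₃ e, ?_, ?_, ?_⟩
  · have h1 : ContDiff ℝ ω Real.cos := Real.contDiff_cos
    have h2 : ContDiff ℝ ω Real.sin := Real.contDiff_sin
    fun_prop
  · intro θ
    constructor
    · simp only [add_dotProduct, dotProduct_add, smul_dotProduct, dotProduct_smul, he, hf, hef,
        dotProduct_comm _ e, smul_eq_mul]
      linear_combination Real.cos_sq_add_sin_sq θ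
    · simp only [dotProduct_add, dotProduct_smul, hbe, hbf]
      simp
  · intro u hu hbu
    have hexp : u = (e ⬝ᵥ u) • e + ((b ⨯₃ e) ⬝ᵥ u) • b ⨯₃ e := by
      have h1 : b ⨯₃ (e ⨯₃ u) = 0 := by
        rw [cross_cross_eq_smul_sub_smul', hbu, dotProduct_comm, hbe]; simp
      have h2 := cross_cross_eq_smul_sub_smul e u e
      rw [eq_smul_of_cross_eq_zero hb h1, map_smul, LinearMap.smul_apply, he, one_smul,
        triple_product_permutation, triple_product_permutation] at h2
      rw [dotProduct_comm e u, dotProduct_comm _ u, h2]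
      simp
    have hsq : (e ⬝ᵥ u) ^ 2 + ((b ⨯₃ e) ⬝ᵥ u) ^ 2 = 1 := by
      have h1 := congrArg (fun t => t ⬝ᵥ u) hexp
      simp only [add_dotProduct, smul_dotProduct, hu, smul_eq_mul] at h1
      linarith
    obtain ⟨θ, h1, h2⟩ : ∃ θ, Real.cos θ = e ⬝ᵥ u ∧ Real.sin θ = (b ⨯₃ e) ⬝ᵥ u := by
      generalize (b ⨯₃ e) ⬝ᵥ u = y at hsq
      generalize e ⬝ᵥ u = x at hsq
      have hx : -1 ≤ x ∧ x ≤ 1 := by constructor <;> nlinarith [sq_nonneg y]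
      have hs : √(1 - x ^ 2) = |y| := by rw [← Real.sqrt_sq_eq_abs]; congr 1; linarith
      rcases le_total 0 y with hy | hy
      · exact ⟨Real.arccos x, Real.cos_arccos hx.1 hx.2,
          by rw [Real.sin_arccos, hs, abs_of_nonneg hy]⟩
      · exact ⟨-Real.arccos x, by rw [Real.cos_neg, Real.cos_arccos hx.1 hx.2],
          by rw [Real.sin_neg, Real.sin_arccos, hs, abs_of_nonpos hy, neg_neg]⟩
    exact ⟨θ, by beta_reduce; rw [h1, h2]; exact hexp.symm⟩

end Vectors

/-! ### General position on the sphere: adding a vertex -/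

section Generic
open Matrix Filter Topology
open scoped ContDiff

/-- The vectors `g p`, `p ∈ S`, form an orthogonal representation of `G` on the unit sphere which is
in general position. Namely, only adjacent vertices are orthogonal (`nadj`), any two and any three
vectors are linearly independent (`pair`, `triple`), and a plane through three vectors contains
neither a fourth vector nor its opposite (`plane`). The last three conditions concern the unit
vectors `± m` orthogonal to `g v` and `g w`: for vertices not adjacent to `v` and `w`, the vector
`m` is independent of two others (`cross_pair`; `cross_self` says `(g v × g w) · (g v × g z) ≠ 0`
and deals with the independence of `m`, `g v` and `g z`), and neither `m` nor `-m` lies on the plane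
through three others (`cross_plane`). -/
structure IsGeneric {V : Type*} (G : SimpleGraph V) (S : Finset V) (g : V → Fin 3 → ℝ) : Prop where
  unit : ∀ p ∈ S, g p ⬝ᵥ g p = 1
  adj : ∀ p ∈ S, ∀ q ∈ S, G.Adj p q → g p ⬝ᵥ g q = 0
  nadj : ∀ p ∈ S, ∀ q ∈ S, p ≠ q → ¬ G.Adj p q → g p ⬝ᵥ g q ≠ 0
  pair : ∀ p ∈ S, ∀ q ∈ S, p ≠ q → (g p ⬝ᵥ g q) ^ 2 ≠ 1
  triple : ∀ p ∈ S, ∀ q ∈ S, ∀ r ∈ S, p ≠ q → p ≠ r → q ≠ r → tripleProd (g p) (g q) (g r) ≠ 0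
  plane : ∀ a ∈ S, ∀ p ∈ S, ∀ q ∈ S, ∀ r ∈ S, a ≠ p → a ≠ q → a ≠ r → p ≠ q → p ≠ r → q ≠ r →
    (g a ⬝ᵥ planeNormal (g p) (g q) (g r)) ^ 2 ≠ tripleProd (g p) (g q) (g r) ^ 2
  cross_pair : ∀ v ∈ S, ∀ w ∈ S, ∀ y ∈ S, ∀ z ∈ S, v ≠ w → y ≠ z → v ≠ y → v ≠ z → w ≠ y → w ≠ z →
    ¬ G.Adj v y → ¬ G.Adj v z → ¬ G.Adj w y → ¬ G.Adj w z → g v ⨯₃ g w ⬝ᵥ g y ⨯₃ g z ≠ 0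
  cross_self : ∀ v ∈ S, ∀ w ∈ S, ∀ z ∈ S, v ≠ w → v ≠ z → w ≠ z →
    ¬ G.Adj v z → ¬ G.Adj w z → g w ⬝ᵥ g z ≠ (g v ⬝ᵥ g z) * (g v ⬝ᵥ g w)
  cross_plane : ∀ v ∈ S, ∀ w ∈ S, ∀ p ∈ S, ∀ q ∈ S, ∀ r ∈ S, v ≠ w → p ≠ q → p ≠ r → q ≠ r →
    v ≠ p → v ≠ q → v ≠ r → w ≠ p → w ≠ q → w ≠ r →
    ¬ G.Adj v p → ¬ G.Adj v q → ¬ G.Adj v r → ¬ G.Adj w p → ¬ G.Adj w q → ¬ G.Adj w r →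
    (g v ⨯₃ g w ⬝ᵥ planeNormal (g p) (g q) (g r)) ^ 2 ≠
      (g v ⨯₃ g w ⬝ᵥ g v ⨯₃ g w) * tripleProd (g p) (g q) (g r) ^ 2

/-- The conditions on a vector `u` under which general position persists when `u` is added as the
vector of a new vertex `v`. An index tells which of the roles in a condition of `IsGeneric` the new
vertex plays; roles that symmetries of the condition exchange are listed once. -/
structure IsGenericStep {V : Type*} (G : SimpleGraph V) (S : Finset V) (g : V → Fin 3 → ℝ)
    (v : V) (u : Fin 3 → ℝ) : Prop where
  unit : u ⬝ᵥ u = 1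
  adj : ∀ p ∈ S, G.Adj v p → u ⬝ᵥ g p = 0
  nadj : ∀ p ∈ S, ¬ G.Adj v p → u ⬝ᵥ g p ≠ 0
  pair : ∀ p ∈ S, (u ⬝ᵥ g p) ^ 2 ≠ 1
  triple : ∀ p ∈ S, ∀ q ∈ S, p ≠ q → tripleProd u (g p) (g q) ≠ 0
  plane₁ : ∀ p ∈ S, ∀ q ∈ S, ∀ r ∈ S, p ≠ q → p ≠ r → q ≠ r →
    (u ⬝ᵥ planeNormal (g p) (g q) (g r)) ^ 2 ≠ tripleProd (g p) (g q) (g r) ^ 2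
  plane₂ : ∀ a ∈ S, ∀ q ∈ S, ∀ r ∈ S, a ≠ q → a ≠ r → q ≠ r →
    (g a ⬝ᵥ planeNormal u (g q) (g r)) ^ 2 ≠ tripleProd u (g q) (g r) ^ 2
  cross_pair : ∀ w ∈ S, ∀ y ∈ S, ∀ z ∈ S, y ≠ z → w ≠ y → w ≠ z →
    ¬ G.Adj v y → ¬ G.Adj v z → ¬ G.Adj w y → ¬ G.Adj w z → u ⨯₃ g w ⬝ᵥ g y ⨯₃ g z ≠ 0
  cross_self₁ : ∀ w ∈ S, ∀ z ∈ S, w ≠ z →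
    ¬ G.Adj v z → ¬ G.Adj w z → g w ⬝ᵥ g z ≠ (u ⬝ᵥ g z) * (u ⬝ᵥ g w)
  cross_self₂ : ∀ w ∈ S, ∀ z ∈ S, w ≠ z →
    ¬ G.Adj w z → ¬ G.Adj v z → u ⬝ᵥ g z ≠ (g w ⬝ᵥ g z) * (g w ⬝ᵥ u)
  cross_self₃ : ∀ w ∈ S, ∀ y ∈ S, w ≠ y →
    ¬ G.Adj w v → ¬ G.Adj y v → g y ⬝ᵥ u ≠ (g w ⬝ᵥ u) * (g w ⬝ᵥ g y)
  cross_plane₁ : ∀ w ∈ S, ∀ p ∈ S, ∀ q ∈ S, ∀ r ∈ S, p ≠ q → p ≠ r → q ≠ r →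
    w ≠ p → w ≠ q → w ≠ r →
    ¬ G.Adj v p → ¬ G.Adj v q → ¬ G.Adj v r → ¬ G.Adj w p → ¬ G.Adj w q → ¬ G.Adj w r →
    (u ⨯₃ g w ⬝ᵥ planeNormal (g p) (g q) (g r)) ^ 2 ≠
      (u ⨯₃ g w ⬝ᵥ u ⨯₃ g w) * tripleProd (g p) (g q) (g r) ^ 2
  cross_plane₂ : ∀ y ∈ S, ∀ w ∈ S, ∀ q ∈ S, ∀ r ∈ S, y ≠ w → q ≠ r →
    y ≠ q → y ≠ r → w ≠ q → w ≠ r →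
    ¬ G.Adj y v → ¬ G.Adj y q → ¬ G.Adj y r → ¬ G.Adj w v → ¬ G.Adj w q → ¬ G.Adj w r →
    (g y ⨯₃ g w ⬝ᵥ planeNormal u (g q) (g r)) ^ 2 ≠
      (g y ⨯₃ g w ⬝ᵥ g y ⨯₃ g w) * tripleProd u (g q) (g r) ^ 2

variable {V : Type*} {G : SimpleGraph V} {S : Finset V} {g : V → Fin 3 → ℝ} {v : V}

lemma IsGeneric.insert [DecidableEq V] (h : IsGeneric G S g)
    (hs : IsGenericStep G S g v (g v)) : IsGeneric G (insert v S) g where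
  unit p kp := by
    rcases Finset.mem_insert.1 kp with rfl | hp
    · exact hs.unit
    · exact h.unit p hp
  adj p kp q kq hpq := by
    rcases Finset.mem_insert.1 kp with rfl | hp <;> rcases Finset.mem_insert.1 kq with rfl | hq
    · exact absurd hpq (G.irrefl)
    · exact hs.adj q hq hpq
    · rw [dotProduct_comm]; exact hs.adj p hp hpq.symm
    · exact h.adj p hp q hq hpq
  nadj p kp q kq hne hpq := by
    rcases Finset.mem_insert.1 kp with rfl | hp <;> rcases Finset.mem_insert.1 kq with rfl | hq
    · exact absurd rfl hne
    · exact hs.nadj q hq hpq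
    · rw [dotProduct_comm]; exact hs.nadj p hp (fun h => hpq h.symm)
    · exact h.nadj p hp q hq hne hpq
  pair p kp q kq hne := by
    rcases Finset.mem_insert.1 kp with rfl | hp <;> rcases Finset.mem_insert.1 kq with rfl | hq
    · exact absurd rfl hne
    · exact hs.pair q hq
    · rw [dotProduct_comm]; exact hs.pair p hp
    · exact h.pair p hp q hq hne
  triple p kp q kq r kr h1 h2 h3 := by
    rcases Finset.mem_insert.1 kp with rfl | hp <;> rcases Finset.mem_insert.1 kq with rfl | hq <;>
      rcases Finset.mem_insert.1 kr with rfl | hr <;> try contradiction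
    · exact hs.triple q hq r hr h3
    · rw [← tripleProd_rot]; exact hs.triple r hr p hp h2.symm
    · rw [tripleProd_rot]; exact hs.triple p hp q hq h1
    · exact h.triple p hp q hq r hr h1 h2 h3
  plane a ka p kp q kq r kr h1 h2 h3 h4 h5 h6 := by
    rcases Finset.mem_insert.1 ka with rfl | ha <;> rcases Finset.mem_insert.1 kp with rfl | hp <;>
      rcases Finset.mem_insert.1 kq with rfl | hq <;>
      rcases Finset.mem_insert.1 kr with rfl | hr <;> try contradiction
    · exact hs.plane₁ p hp q hq r hr h4 h5 h6
    · exact hs.plane₂ a ha q hq r hr h2 h3 h6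
    · rw [← planeNormal_rot, ← tripleProd_rot]; exact hs.plane₂ a ha r hr p hp h3 h1 h5.symm
    · rw [planeNormal_rot, tripleProd_rot]; exact hs.plane₂ a ha p hp q hq h1 h2 h4
    · exact h.plane a ha p hp q hq r hr h1 h2 h3 h4 h5 h6
  cross_pair p kp w kw y ky z kz h1 h2 h3 h4 h5 h6 a1 a2 a3 a4 := by
    rcases Finset.mem_insert.1 kp with rfl | hp <;> rcases Finset.mem_insert.1 kw with rfl | hw <;>
      rcases Finset.mem_insert.1 ky with rfl | hy <;>
      rcases Finset.mem_insert.1 kz with rfl | hz <;> try contradiction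
    · exact hs.cross_pair w hw y hy z hz h2 h5 h6 a1 a2 a3 a4
    · rw [← cross_anticomm, neg_dotProduct, neg_ne_zero]
      exact hs.cross_pair p hp y hy z hz h2 h3 h4 a3 a4 a1 a2
    · rw [dotProduct_comm]
      exact hs.cross_pair z hz p hp w hw h1 h4.symm h6.symm (fun h => a1 h.symm)
        (fun h => a3 h.symm) (fun h => a2 h.symm) (fun h => a4 h.symm)
    · rw [dotProduct_comm, ← cross_anticomm, neg_dotProduct, neg_ne_zero]
      exact hs.cross_pair y hy p hp w hw h1 h3.symm h5.symm (fun h => a2 h.symm)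
        (fun h => a4 h.symm) (fun h => a1 h.symm) (fun h => a3 h.symm)
    · exact h.cross_pair p hp w hw y hy z hz h1 h2 h3 h4 h5 h6 a1 a2 a3 a4
  cross_self p kp w kw z kz h1 h2 h3 a1 a2 := by
    rcases Finset.mem_insert.1 kp with rfl | hp <;> rcases Finset.mem_insert.1 kw with rfl | hw <;>
      rcases Finset.mem_insert.1 kz with rfl | hz <;> try contradiction
    · exact hs.cross_self₁ w hw z hz h3 a1 a2
    · exact hs.cross_self₂ p hp z hz h2 a1 a2
    · exact hs.cross_self₃ p hp w hw h1 a1 a2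
    · exact h.cross_self p hp w hw z hz h1 h2 h3 a1 a2
  cross_plane y ky w kw p kp q kq r kr h1 h2 h3 h4 h5 h6 h7 h8 h9 h10 a1 a2 a3 a4 a5 a6 := by
    rcases Finset.mem_insert.1 ky with rfl | hy <;> rcases Finset.mem_insert.1 kw with rfl | hw <;>
      rcases Finset.mem_insert.1 kp with rfl | hp <;>
      rcases Finset.mem_insert.1 kq with rfl | hq <;>
      rcases Finset.mem_insert.1 kr with rfl | hr <;> try contradiction
    · exact hs.cross_plane₁ w hw p hp q hq r hr h2 h3 h4 h8 h9 h10 a1 a2 a3 a4 a5 a6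
    · have := hs.cross_plane₁ y hy p hp q hq r hr h2 h3 h4 h5 h6 h7 a4 a5 a6 a1 a2 a3
      rwa [← cross_anticomm, neg_dotProduct, neg_dotProduct, dotProduct_neg, neg_neg, neg_sq]
    · exact hs.cross_plane₂ y hy w hw q hq r hr h1 h4 h6 h7 h9 h10 a1 a2 a3 a4 a5 a6
    · rw [← planeNormal_rot, ← tripleProd_rot]
      exact hs.cross_plane₂ y hy w hw r hr p hp h1 h3.symm h7 h5 h10 h8 a2 a3 a1 a5 a6 a4
    · rw [planeNormal_rot, tripleProd_rot]
      exact hs.cross_plane₂ y hy w hw p hp q hq h1 h2 h5 h6 h8 h9 a3 a1 a2 a6 a4 a5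
    · exact h.cross_plane y hy w hw p hp q hq r hr h1 h2 h3 h4 h5 h6 h7 h8 h9 h10 a1 a2 a3 a4 a5 a6

/-- The unit vector `b` is an axis for placing `v`: if `u ⟂ b`, then `u` is orthogonal to the
vectors of the neighbours of `v`, of which there is at most one by `adj`. The other conditions
guarantee that a generic unit vector orthogonal to `b` is in general position with respect to `g`.
-/
structure IsGenericAxis (G : SimpleGraph V) (S : Finset V) (g : V → Fin 3 → ℝ) (v : V)
    (b : Fin 3 → ℝ) : Prop where
  unit : b ⬝ᵥ b = 1
  adj : ∀ p ∈ S, G.Adj v p → g p = b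
  pair : ∀ p ∈ S, ¬ G.Adj v p → b ⨯₃ g p ≠ 0
  triple : ∀ p ∈ S, ∀ q ∈ S, p ≠ q → ¬ G.Adj v p → ¬ G.Adj v q → tripleProd b (g p) (g q) ≠ 0
  perp : ∀ p ∈ S, ∀ q ∈ S, p ≠ q → b ⬝ᵥ g p = 0 → b ⬝ᵥ g q = 0 → False
  plane : ∀ w ∈ S, b ⬝ᵥ g w = 0 → ∀ p ∈ S, ∀ q ∈ S, ∀ r ∈ S, p ≠ q → p ≠ r → q ≠ r →
    ¬ G.Adj v p → ¬ G.Adj v q → ¬ G.Adj v r →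
    (b ⬝ᵥ planeNormal (g p) (g q) (g r)) ^ 2 ≠ tripleProd (g p) (g q) (g r) ^ 2

lemma eventually_imp_intro {α : Type*} {l : Filter α} {p : Prop} {q : α → Prop}
    (h : p → ∀ᶠ x in l, q x) : ∀ᶠ x in l, p → q x := by
  by_cases hp : p
  · exact (h hp).mono fun _ hx _ => hx
  · exact Eventually.of_forall fun _ h => absurd h hp

lemma contDiff_dot {c d : ℝ → Fin 3 → ℝ} (hc : ContDiff ℝ ω c) (hd : ContDiff ℝ ω d) :
    ContDiff ℝ ω fun θ => c θ ⬝ᵥ d θ := by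
  simp only [dot3]
  fun_prop

lemma contDiff_cross {c d : ℝ → Fin 3 → ℝ} (hc : ContDiff ℝ ω c) (hd : ContDiff ℝ ω d) :
    ContDiff ℝ ω fun θ => c θ ⨯₃ d θ := by
  refine contDiff_pi.2 fun i => ?_
  fin_cases i
  · simp only [Fin.zero_eta, cross0]; fun_prop
  · simp only [Fin.mk_one, cross1]; fun_prop
  · simp only [Fin.reduceFinMk, cross2]; fun_prop

/-- Each condition of `IsGenericStep` says that an analytic function on the circle orthogonal to the
axis does not vanish. It is enough to find, for each function separately, one point where it is
nonzero. -/
lemma exists_isGenericStep [Finite V] (h : IsGeneric G S g) {b : Fin 3 → ℝ}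
    (hb : IsGenericAxis G S g v b) : ∃ u, IsGenericStep G S g v u := by
  obtain ⟨c, hc, hc1, hc2⟩ := exists_circle_param hb.unit
  have hw : ∀ F : ℝ → ℝ, ContDiff ℝ ω F → (∃ θ, F θ ≠ 0) → ∀ᶠ θ in 𝓝[≠] 0, F θ ≠ 0 :=
    fun F hF => eventually_ne_zero_of_analytic hF
  have perp : ∀ K, ∃ θ, c θ ⬝ᵥ K = 0 := fun K => by
    obtain ⟨u, h1, h2, h3⟩ := exists_perp_perp_unit hb.unit K
    obtain ⟨θ, rfl⟩ := hc2 u h1 h2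
    exact ⟨θ, h3⟩
  have nperp : ∀ K, b ⨯₃ K ≠ 0 → ∃ θ, c θ ⬝ᵥ K ≠ 0 := fun K hK => by
    obtain ⟨u, h1, h2, h3⟩ := exists_perp_not_perp_unit hb.unit hK
    obtain ⟨θ, rfl⟩ := hc2 u h1 h2
    exact ⟨θ, h3⟩
  -- a linear condition: it fails to hold identically as soon as `K` is not parallel to `b`
  have lin : ∀ K, b ⨯₃ K ≠ 0 → ∀ᶠ θ in 𝓝[≠] 0, c θ ⬝ᵥ K ≠ 0 := fun K hK =>
    hw _ (contDiff_dot hc contDiff_const) (nperp K hK)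
  -- an affine condition with nonzero constant term
  have aff : ∀ (K) (a : ℝ), a ≠ 0 → ∀ᶠ θ in 𝓝[≠] 0, a + c θ ⬝ᵥ K ≠ 0 := fun K a ha =>
    hw _ (contDiff_const.add (contDiff_dot hc contDiff_const)) (by
      obtain ⟨θ, hθ⟩ := perp K
      exact ⟨θ, by rw [hθ]; simpa using ha⟩)
  -- a vector `K` in the span of two vectors `y`, `z` independent from `b` is not parallel to `b`
  have span : ∀ y z : Fin 3 → ℝ, tripleProd b y z ≠ 0 → ∀ α β : ℝ, b ⨯₃ (α • y + β • z) = 0 →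
      α • y + β • z = 0 := by
    intro y z hyz α β hK
    have h1 := eq_smul_of_cross_eq_zero hb.unit hK
    have h2 : (α • y + β • z) ⬝ᵥ y ⨯₃ z = 0 := by
      simp [add_dotProduct, smul_dotProduct]
    rw [h1, smul_dotProduct, smul_eq_mul] at h2
    rw [h1, (mul_eq_zero.1 h2).resolve_right hyz, zero_smul]
  have e2 : ∀ᶠ θ in 𝓝[≠] 0, ∀ p, p ∈ S → ¬ G.Adj v p → c θ ⬝ᵥ g p ≠ 0 :=
    eventually_all.2 fun p => eventually_imp_intro fun hp => eventually_imp_intro fun ha =>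
      lin _ (hb.pair p hp ha)
  have e2' : ∀ᶠ θ in 𝓝[≠] 0, ∀ p, p ∈ S → (c θ ⬝ᵥ g p) ^ 2 ≠ 1 :=
    eventually_all.2 fun p => eventually_imp_intro fun hp => by
      refine (hw (fun θ => (c θ ⬝ᵥ g p) ^ 2 - 1) ?_ ?_).mono fun θ hθ => sub_ne_zero.1 hθ
      · exact ((contDiff_dot hc contDiff_const).pow 2).sub contDiff_const
      · obtain ⟨θ, hθ⟩ := perp (g p)
        exact ⟨θ, by rw [hθ]; norm_num⟩
  have e3 : ∀ᶠ θ in 𝓝[≠] 0, ∀ p q, p ∈ S → q ∈ S → p ≠ q → tripleProd (c θ) (g p) (g q) ≠ 0 :=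
    eventually_all.2 fun p => eventually_all.2 fun q => eventually_imp_intro fun hp =>
      eventually_imp_intro fun hq => eventually_imp_intro fun hpq => lin _ fun h0 => by
        rw [cross_cross_eq_smul_sub_smul', sub_eq_zero] at h0
        have h1 := eq_zero_of_smul_eq_smul (h.unit p hp) (h.unit q hq) (h.pair p hp q hq hpq) h0
        have h2 := eq_zero_of_smul_eq_smul (h.unit q hq) (h.unit p hp)
          (h.pair q hq p hp hpq.symm) h0.symm
        exact hb.perp p hp q hq hpq (by rwa [dotProduct_comm]) h1
  have e4 : ∀ᶠ θ in 𝓝[≠] 0, ∀ p q r, p ∈ S → q ∈ S → r ∈ S → p ≠ q → p ≠ r → q ≠ r →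
      (c θ ⬝ᵥ planeNormal (g p) (g q) (g r)) ^ 2 ≠ tripleProd (g p) (g q) (g r) ^ 2 :=
    eventually_all.2 fun p => eventually_all.2 fun q => eventually_all.2 fun r =>
      eventually_imp_intro fun hp => eventually_imp_intro fun hq => eventually_imp_intro fun hr =>
      eventually_imp_intro fun h1 => eventually_imp_intro fun h2 => eventually_imp_intro fun h3 => by
      refine (hw (fun θ => (c θ ⬝ᵥ planeNormal (g p) (g q) (g r)) ^ 2
        - tripleProd (g p) (g q) (g r) ^ 2) ?_ ?_).mono fun θ hθ => sub_ne_zero.1 hθ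
      · exact ((contDiff_dot hc contDiff_const).pow 2).sub contDiff_const
      · obtain ⟨θ, hθ⟩ := perp (planeNormal (g p) (g q) (g r))
        refine ⟨θ, ?_⟩
        rw [hθ]
        simpa using h.triple p hp q hq r hr h1 h2 h3
  have e5 : ∀ᶠ θ in 𝓝[≠] 0, ∀ a q r, a ∈ S → q ∈ S → r ∈ S → a ≠ q → a ≠ r → q ≠ r →
      (g a ⬝ᵥ planeNormal (c θ) (g q) (g r)) ^ 2 ≠ tripleProd (c θ) (g q) (g r) ^ 2 :=
    eventually_all.2 fun a => eventually_all.2 fun q => eventually_all.2 fun r =>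
      eventually_imp_intro fun ha => eventually_imp_intro fun hq => eventually_imp_intro fun hr =>
      eventually_imp_intro fun h1 => eventually_imp_intro fun h2 => eventually_imp_intro fun h3 => by
      have h0 : g a ⬝ᵥ g q ⨯₃ g r ≠ 0 := h.triple a ha q hq r hr h1 h2 h3
      filter_upwards [aff (g q ⨯₃ g a + g a ⨯₃ g r - g q ⨯₃ g r) _ h0,
        aff (g q ⨯₃ g a + g a ⨯₃ g r + g q ⨯₃ g r) _ h0] with θ t1 t2 t
      refine mul_ne_zero t1 t2 ?_
      rw [← sub_eq_zero] at t
      rw [← t]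
      simp only [planeNormal, tripleProd, dot3, Pi.add_apply, Pi.sub_apply, cross0, cross1, cross2]
      ring
  have e6 : ∀ᶠ θ in 𝓝[≠] 0, ∀ w y z, w ∈ S → y ∈ S → z ∈ S → y ≠ z → w ≠ y → w ≠ z →
      ¬ G.Adj v y → ¬ G.Adj v z → ¬ G.Adj w y → ¬ G.Adj w z → c θ ⨯₃ g w ⬝ᵥ g y ⨯₃ g z ≠ 0 :=
    eventually_all.2 fun w => eventually_all.2 fun y => eventually_all.2 fun z =>
      eventually_imp_intro fun hw => eventually_imp_intro fun hy => eventually_imp_intro fun hz =>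
      eventually_imp_intro fun h1 => eventually_imp_intro fun h2 => eventually_imp_intro fun h3 =>
      eventually_imp_intro fun a1 => eventually_imp_intro fun a2 => eventually_imp_intro fun a3 =>
      eventually_imp_intro fun a4 => by
      refine (lin ((g w ⬝ᵥ g z) • g y + (-(g w ⬝ᵥ g y)) • g z) fun h0 => ?_).mono fun θ hθ => ?_
      · have h4 := span _ _ (hb.triple y hy z hz h1 a1 a2) _ _ h0
        rw [neg_smul, ← sub_eq_add_neg, sub_eq_zero] at h4
        exact h.nadj w hw z hz h3 a4
          (eq_zero_of_smul_eq_smul (h.unit y hy) (h.unit z hz) (h.pair y hy z hz h1) h4)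
      · rw [dotProduct_add, dotProduct_smul, dotProduct_smul] at hθ
        rw [cross_dot_cross]
        intro h0
        apply hθ
        simp only [smul_eq_mul]
        linarith
  have e7 : ∀ᶠ θ in 𝓝[≠] 0, ∀ w z, w ∈ S → z ∈ S → w ≠ z →
      ¬ G.Adj v z → ¬ G.Adj w z → g w ⬝ᵥ g z ≠ (c θ ⬝ᵥ g z) * (c θ ⬝ᵥ g w) :=
    eventually_all.2 fun w => eventually_all.2 fun z =>
      eventually_imp_intro fun hw' => eventually_imp_intro fun hz =>
      eventually_imp_intro fun h1 => eventually_imp_intro fun a1 => eventually_imp_intro fun a2 => by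
      refine (hw (fun θ => g w ⬝ᵥ g z - (c θ ⬝ᵥ g z) * (c θ ⬝ᵥ g w)) ?_ ?_).mono
        fun θ hθ => sub_ne_zero.1 hθ
      · exact contDiff_const.sub
          ((contDiff_dot hc contDiff_const).mul (contDiff_dot hc contDiff_const))
      · obtain ⟨θ, hθ⟩ := perp (g w)
        refine ⟨θ, ?_⟩
        rw [hθ]
        simpa using h.nadj w hw' z hz h1 a2
  have e8 : ∀ᶠ θ in 𝓝[≠] 0, ∀ w z, w ∈ S → z ∈ S → w ≠ z →
      ¬ G.Adj w z → ¬ G.Adj v z → c θ ⬝ᵥ g z ≠ (g w ⬝ᵥ g z) * (g w ⬝ᵥ c θ) :=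
    eventually_all.2 fun w => eventually_all.2 fun z =>
      eventually_imp_intro fun hw' => eventually_imp_intro fun hz =>
      eventually_imp_intro fun h1 => eventually_imp_intro fun a1 => eventually_imp_intro fun a2 => by
      have hne : (1 : ℝ) • g z + (-(g w ⬝ᵥ g z)) • g w ≠ 0 := fun h4 => by
        rw [neg_smul, ← sub_eq_add_neg, sub_eq_zero] at h4
        exact one_ne_zero (eq_zero_of_smul_eq_smul (h.unit z hz) (h.unit w hw')
          (h.pair z hz w hw' h1.symm) h4)
      refine (lin ((1 : ℝ) • g z + (-(g w ⬝ᵥ g z)) • g w) fun h0 => ?_).mono fun θ hθ => ?_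
      · by_cases hvw : G.Adj v w
        · -- here `w` carries the axis `b`, which is orthogonal to the vector in question
          have h5 := eq_smul_of_cross_eq_zero hb.unit h0
          rw [← hb.adj w hw' hvw] at h5
          have h6 : g w ⬝ᵥ ((1 : ℝ) • g z + (-(g w ⬝ᵥ g z)) • g w) = 0 := by
            rw [dotProduct_add, dotProduct_smul, dotProduct_smul, h.unit w hw']
            simp
          rw [h6, zero_smul] at h5
          exact hne h5
        · exact hne (span _ _ (hb.triple z hz w hw' h1.symm a2 hvw) _ _ h0)
      · rw [dotProduct_add, dotProduct_smul, dotProduct_smul] at hθ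
        intro h0
        apply hθ
        rw [h0, dotProduct_comm (g w) (c θ)]
        simp only [smul_eq_mul]
        ring
  have e9 : ∀ᶠ θ in 𝓝[≠] 0, ∀ w y, w ∈ S → y ∈ S → w ≠ y →
      ¬ G.Adj w v → ¬ G.Adj y v → g y ⬝ᵥ c θ ≠ (g w ⬝ᵥ c θ) * (g w ⬝ᵥ g y) :=
    eventually_all.2 fun w => eventually_all.2 fun y =>
      eventually_imp_intro fun hw' => eventually_imp_intro fun hy =>
      eventually_imp_intro fun h1 => eventually_imp_intro fun a1 => eventually_imp_intro fun a2 => by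
      refine (lin ((1 : ℝ) • g y + (-(g w ⬝ᵥ g y)) • g w) fun h0 => ?_).mono fun θ hθ => ?_
      · have h4 := span _ _ (hb.triple y hy w hw' h1.symm (fun h => a2 h.symm)
          (fun h => a1 h.symm)) _ _ h0
        rw [neg_smul, ← sub_eq_add_neg, sub_eq_zero] at h4
        exact one_ne_zero (eq_zero_of_smul_eq_smul (h.unit y hy) (h.unit w hw')
          (h.pair y hy w hw' h1.symm) h4)
      · rw [dotProduct_add, dotProduct_smul, dotProduct_smul] at hθ
        intro h0
        apply hθ
        rw [dotProduct_comm (c θ) (g y), h0, dotProduct_comm (g w) (c θ)]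
        simp only [smul_eq_mul]
        ring
  have e10 : ∀ᶠ θ in 𝓝[≠] 0, ∀ w p q r, w ∈ S → p ∈ S → q ∈ S → r ∈ S → p ≠ q → p ≠ r → q ≠ r →
      w ≠ p → w ≠ q → w ≠ r →
      ¬ G.Adj v p → ¬ G.Adj v q → ¬ G.Adj v r → ¬ G.Adj w p → ¬ G.Adj w q → ¬ G.Adj w r →
      (c θ ⨯₃ g w ⬝ᵥ planeNormal (g p) (g q) (g r)) ^ 2 ≠
        (c θ ⨯₃ g w ⬝ᵥ c θ ⨯₃ g w) * tripleProd (g p) (g q) (g r) ^ 2 :=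
    eventually_all.2 fun w => eventually_all.2 fun p => eventually_all.2 fun q =>
      eventually_all.2 fun r =>
      eventually_imp_intro fun hw' => eventually_imp_intro fun hp => eventually_imp_intro fun hq =>
      eventually_imp_intro fun hr =>
      eventually_imp_intro fun h1 => eventually_imp_intro fun h2 => eventually_imp_intro fun h3 =>
      eventually_imp_intro fun h4 => eventually_imp_intro fun h5 => eventually_imp_intro fun h6 =>
      eventually_imp_intro fun a1 => eventually_imp_intro fun a2 => eventually_imp_intro fun a3 =>
      eventually_imp_intro fun a4 => eventually_imp_intro fun a5 => eventually_imp_intro fun a6 => by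
      have hD := h.triple p hp q hq r hr h1 h2 h3
      set M := planeNormal (g p) (g q) (g r) with hM
      set D := tripleProd (g p) (g q) (g r) with hDd
      refine (hw (fun θ => (c θ ⨯₃ g w ⬝ᵥ M) ^ 2 - (c θ ⨯₃ g w ⬝ᵥ c θ ⨯₃ g w) * D ^ 2) ?_ ?_).mono
        fun θ hθ => sub_ne_zero.1 hθ
      · have hx : ContDiff ℝ ω fun θ => c θ ⨯₃ g w := contDiff_cross hc contDiff_const
        exact ((contDiff_dot hx contDiff_const).pow 2).sub ((contDiff_dot hx hx).mul contDiff_const)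
      · have hsq : ∀ θ, c θ ⨯₃ g w ⬝ᵥ c θ ⨯₃ g w = 1 - (c θ ⬝ᵥ g w) ^ 2 := fun θ => by
          rw [cross_dot_cross, (hc1 θ).1, h.unit w hw', dotProduct_comm (g w)]; ring
        by_cases hbw : b ⬝ᵥ g w = 0
        · -- if `b ⟂ g w`, take the unit vector orthogonal to both
          obtain ⟨θ, hθ⟩ := hc2 (b ⨯₃ g w) (by
            rw [cross_dot_cross, hb.unit, h.unit w hw', hbw]; ring) (dot_self_cross _ _)
          refine ⟨θ, ?_⟩
          have h7 : c θ ⨯₃ g w = -b := by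
            rw [hθ, cross_cross_eq_smul_sub_smul, hbw, h.unit w hw']; simp
          have := hb.plane w hw' hbw p hp q hq r hr h1 h2 h3 a1 a2 a3
          simp only [h7, neg_dotProduct, dotProduct_neg, neg_neg, hb.unit, neg_sq, one_mul]
          exact sub_ne_zero.2 this
        · obtain ⟨θ, hθ⟩ := perp (g w ⨯₃ M)
          refine ⟨θ, ?_⟩
          have h7 : c θ ⨯₃ g w ⬝ᵥ M = 0 := by
            rw [dotProduct_comm, triple_product_permutation, hθ]
          have h8 : (c θ ⬝ᵥ g w) ^ 2 ≠ 1 := by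
            intro h8
            have h9 := hsq θ
            rw [h8, sub_self] at h9
            have h10 := eq_smul_of_cross_eq_zero (hc1 θ).1 (dot_self_eq_zero3 h9)
            rw [h10, dotProduct_smul, (hc1 θ).2, smul_zero] at hbw
            exact hbw rfl
          rw [h7, hsq]
          have h9 : 1 - (c θ ⬝ᵥ g w) ^ 2 ≠ 0 := sub_ne_zero.2 (Ne.symm h8)
          have := mul_ne_zero h9 (pow_ne_zero 2 hD)
          simpa using this
  have e11 : ∀ᶠ θ in 𝓝[≠] 0, ∀ y w q r, y ∈ S → w ∈ S → q ∈ S → r ∈ S → y ≠ w → q ≠ r →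
      y ≠ q → y ≠ r → w ≠ q → w ≠ r →
      ¬ G.Adj y v → ¬ G.Adj y q → ¬ G.Adj y r → ¬ G.Adj w v → ¬ G.Adj w q → ¬ G.Adj w r →
      (g y ⨯₃ g w ⬝ᵥ planeNormal (c θ) (g q) (g r)) ^ 2 ≠
        (g y ⨯₃ g w ⬝ᵥ g y ⨯₃ g w) * tripleProd (c θ) (g q) (g r) ^ 2 :=
    eventually_all.2 fun y => eventually_all.2 fun w => eventually_all.2 fun q =>
      eventually_all.2 fun r =>
      eventually_imp_intro fun hy => eventually_imp_intro fun hw' => eventually_imp_intro fun hq =>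
      eventually_imp_intro fun hr =>
      eventually_imp_intro fun h1 => eventually_imp_intro fun h2 => eventually_imp_intro fun h3 =>
      eventually_imp_intro fun h4 => eventually_imp_intro fun h5 => eventually_imp_intro fun h6 =>
      eventually_imp_intro fun a1 => eventually_imp_intro fun a2 => eventually_imp_intro fun a3 =>
      eventually_imp_intro fun a4 => eventually_imp_intro fun a5 => eventually_imp_intro fun a6 => by
      have h0 := h.cross_pair y hy w hw' q hq r hr h1 h2 h3 h4 h5 h6 a2 a3 a5 a6
      set m := g y ⨯₃ g w with hm
      have hN : √(m ⬝ᵥ m) ^ 2 = m ⬝ᵥ m := Real.sq_sqrt (by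
        rw [dot3]; nlinarith [sq_nonneg (m 0), sq_nonneg (m 1), sq_nonneg (m 2)])
      set N := √(m ⬝ᵥ m) with hNd
      filter_upwards [aff (g q ⨯₃ m + m ⨯₃ g r - N • g q ⨯₃ g r) _ h0,
        aff (g q ⨯₃ m + m ⨯₃ g r + N • g q ⨯₃ g r) _ h0] with θ t1 t2 t
      refine mul_ne_zero t1 t2 ?_
      rw [← sub_eq_zero, ← hN] at t
      rw [← t]
      simp only [planeNormal, tripleProd, dot3, Pi.add_apply, Pi.sub_apply, cross0, cross1, cross2,
        Pi.smul_apply, smul_eq_mul]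
      ring
  obtain ⟨θ, t2, t2', t3, t4, t5, t6, t7, t8, t9, t10, t11⟩ :=
    (e2.and <| e2'.and <| e3.and <| e4.and <| e5.and <| e6.and <| e7.and <| e8.and <| e9.and <|
      e10.and e11).exists
  exact ⟨c θ, (hc1 θ).1, fun p hp ha => by rw [hb.adj p hp ha, dotProduct_comm]; exact (hc1 θ).2,
    t2, t2', fun p hp q hq => t3 p q hp hq, fun p hp q hq r hr => t4 p q r hp hq hr,
    fun p hp q hq r hr => t5 p q r hp hq hr, fun p hp q hq r hr => t6 p q r hp hq hr,
    fun p hp q hq => t7 p q hp hq, fun p hp q hq => t8 p q hp hq, fun p hp q hq => t9 p q hp hq,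
    fun w hw p hp q hq r hr => t10 w p q r hw hp hq hr,
    fun w hw p hp q hq r hr => t11 w p q r hw hp hq hr⟩

end Generic

/-! ### Breaking cycles -/

section Closers
open Finset
open scoped Classical

variable {V : Type*} {G : SimpleGraph V}

/-- In a graph of maximum degree two, choosing one vertex from each cycle leaves a forest. The
chosen vertices form the set `R`. Components are not mentioned: what is used of a cycle is that all
vertices near `r ∈ R` have degree two, and of a forest that every subset has a vertex of degree at
most one. -/
lemma exists_closers (S : Finset V) (h2 : ∀ v ∈ S, G.degIn S v ≤ 2) : ∃ R ⊆ S,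
    (∀ r ∈ R, G.degIn S r = 2) ∧
    (∀ r ∈ R, ∀ v ∈ S, G.Adj r v → v ∉ R ∧ G.degIn S v = 2 ∧
      ∀ w ∈ S, G.Adj v w → G.degIn S w = 2) ∧
    (∀ v ∈ S, ∀ r ∈ R, ∀ r' ∈ R, G.Adj v r → G.Adj v r' → r = r') ∧
    ∀ T ⊆ S \ R, T.Nonempty → ∃ v ∈ T, G.degIn T v ≤ 1 := by
  induction S using Finset.strongInduction with
  | H S ih =>
  by_cases hS : S = ∅
  · subst hS
    exact ⟨∅, by simp, by simp, by simp, by simp, fun T hT hne => by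
      simp at hT; simp [hT] at hne⟩
  have step : ∀ {v}, v ∈ S → ∃ R ⊆ S.erase v,
      (∀ r ∈ R, G.degIn (S.erase v) r = 2) ∧
      (∀ r ∈ R, ∀ u ∈ S.erase v, G.Adj r u → u ∉ R ∧ G.degIn (S.erase v) u = 2 ∧
        ∀ w ∈ S.erase v, G.Adj u w → G.degIn (S.erase v) w = 2) ∧
      (∀ u ∈ S.erase v, ∀ r ∈ R, ∀ r' ∈ R, G.Adj u r → G.Adj u r' → r = r') ∧
      ∀ T ⊆ S.erase v \ R, T.Nonempty → ∃ u ∈ T, G.degIn T u ≤ 1 := fun {v} hv =>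
    ih _ (erase_ssubset hv) fun u hu =>
      (degIn_mono G (erase_subset v S) u).trans (h2 u (mem_of_mem_erase hu))
  -- a vertex which keeps two neighbours after the removal of `v` is not adjacent to `v`
  have hnadj : ∀ {v u}, v ∈ S → u ∈ S → G.degIn (S.erase v) u = 2 → ¬ G.Adj u v := by
    intro v u hv hu h hadj
    have h1 := h2 u hu
    rw [degIn_erase hv, h, if_pos hadj] at h1
    omega
  have hdeg : ∀ {v u}, v ∈ S → u ∈ S → G.degIn (S.erase v) u = 2 → G.degIn S u = 2 := by
    intro v u hv hu h
    rw [degIn_erase hv, h, if_neg (hnadj hv hu h)]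
  by_cases hlow : ∃ v ∈ S, G.degIn S v ≤ 1
  · obtain ⟨v, hv, hv1⟩ := hlow
    obtain ⟨R, hR, ha, hb, hc, hd⟩ := step hv
    have hRS : R ⊆ S := hR.trans (erase_subset v S)
    refine ⟨R, hRS, fun r hr => hdeg hv (hRS hr) (ha r hr), ?_, ?_, ?_⟩
    · intro r hr u hu hru
      have huv : u ≠ v := fun h => hnadj hv (hRS hr) (ha r hr) (h ▸ hru)
      obtain ⟨h1, h3, h4⟩ := hb r hr u (mem_erase.2 ⟨huv, hu⟩) hru
      refine ⟨h1, hdeg hv hu h3, fun w hw huw => ?_⟩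
      have hwv : w ≠ v := fun h => hnadj hv hu h3 (h ▸ huw)
      exact hdeg hv hw (h4 w (mem_erase.2 ⟨hwv, hw⟩) huw)
    · intro u hu r hr r' hr' h1 h3
      have huv : u ≠ v := fun h => hnadj hv (hRS hr) (ha r hr) (h ▸ h1.symm)
      exact hc u (mem_erase.2 ⟨huv, hu⟩) r hr r' hr' h1 h3
    · intro T hT hne
      by_cases hvT : v ∈ T
      · exact ⟨v, hvT, (degIn_mono G (hT.trans sdiff_subset) v).trans hv1⟩
      · refine hd T (fun t ht => ?_) hne
        have := mem_sdiff.1 (hT ht)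
        exact mem_sdiff.2 ⟨mem_erase.2 ⟨fun h => hvT (h ▸ ht), this.1⟩, this.2⟩
  · push Not at hlow
    have hall : ∀ v ∈ S, G.degIn S v = 2 := fun v hv => by
      have := hlow v hv
      have := h2 v hv
      omega
    obtain ⟨r, hr⟩ := nonempty_iff_ne_empty.2 hS
    obtain ⟨R, hR, ha, hb, hc, hd⟩ := step hr
    have hRS : R ⊆ S := hR.trans (erase_subset r S)
    have hrR : ∀ ρ ∈ R, ¬ G.Adj ρ r := fun ρ hρ => hnadj hr (hRS hρ) (ha ρ hρ)
    refine ⟨insert r R, insert_subset hr hRS, fun ρ hρ => ?_, ?_, ?_, ?_⟩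
    · exact hall ρ (insert_subset hr hRS hρ)
    · intro ρ hρ v hv hρv
      refine ⟨?_, hall v hv, fun w hw _ => hall w hw⟩
      rcases mem_insert.1 hρ with rfl | hρ
      · rw [mem_insert, not_or]
        exact ⟨hρv.ne', fun h => hrR v h hρv.symm⟩
      · have hvr : v ≠ r := fun h => hrR ρ hρ (h ▸ hρv)
        rw [mem_insert, not_or]
        exact ⟨hvr, (hb ρ hρ v (mem_erase.2 ⟨hvr, hv⟩) hρv).1⟩
    · have key : ∀ u ∈ S, ∀ ρ ∈ R, G.Adj u r → G.Adj u ρ → False := by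
        intro u hu ρ hρ h1 h3
        have hur : u ≠ r := h1.ne
        exact hnadj hr hu (hb ρ hρ u (mem_erase.2 ⟨hur, hu⟩) h3.symm).2.1 h1
      intro u hu ρ kρ ρ' kρ' h1 h3
      rcases mem_insert.1 kρ with rfl | hρ <;> rcases mem_insert.1 kρ' with rfl | hρ'
      · rfl
      · exact (key u hu ρ' hρ' h1 h3).elim
      · exact (key u hu ρ hρ h3 h1).elim
      · have hur : u ≠ r := fun h => hrR ρ hρ (h ▸ h1.symm)
        exact hc u (mem_erase.2 ⟨hur, hu⟩) ρ hρ ρ' hρ' h1 h3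
    · intro T hT hne
      refine hd T (fun t ht => ?_) hne
      have := mem_sdiff.1 (hT ht)
      rw [mem_insert, not_or] at this
      exact mem_sdiff.2 ⟨mem_erase.2 ⟨this.2.1, this.1⟩, this.2.2⟩

end Closers

/-! ### General position on the sphere: existence for forests -/

section GenericExistence
open Finset Matrix
open scoped Classical

variable {V : Type*} {G : SimpleGraph V} {S : Finset V} {g g' : V → Fin 3 → ℝ} {v : V}

lemma IsGeneric.congr (h : IsGeneric G S g) (e : ∀ p ∈ S, g' p = g p) : IsGeneric G S g' where
  unit p hp := by simpa only [e p hp] using h.unit p hp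
  adj p hp q hq := by simpa only [e p hp, e q hq] using h.adj p hp q hq
  nadj p hp q hq := by simpa only [e p hp, e q hq] using h.nadj p hp q hq
  pair p hp q hq := by simpa only [e p hp, e q hq] using h.pair p hp q hq
  triple p hp q hq r hr := by
    simpa only [e p hp, e q hq, e r hr] using h.triple p hp q hq r hr
  plane a ha p hp q hq r hr := by
    simpa only [e a ha, e p hp, e q hq, e r hr] using h.plane a ha p hp q hq r hr
  cross_pair a ha p hp q hq r hr := by
    simpa only [e a ha, e p hp, e q hq, e r hr] using h.cross_pair a ha p hp q hq r hr
  cross_self p hp q hq r hr := by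
    simpa only [e p hp, e q hq, e r hr] using h.cross_self p hp q hq r hr
  cross_plane a ha b hb p hp q hq r hr := by
    simpa only [e a ha, e b hb, e p hp, e q hq, e r hr] using h.cross_plane a ha b hb p hp q hq r hr

lemma IsGenericStep.congr {u : Fin 3 → ℝ} (h : IsGenericStep G S g v u)
    (e : ∀ p ∈ S, g' p = g p) : IsGenericStep G S g' v u where
  unit := h.unit
  adj p hp := by simpa only [e p hp] using h.adj p hp
  nadj p hp := by simpa only [e p hp] using h.nadj p hp
  pair p hp := by simpa only [e p hp] using h.pair p hp
  triple p hp q hq := by simpa only [e p hp, e q hq] using h.triple p hp q hq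
  plane₁ p hp q hq r hr := by
    simpa only [e p hp, e q hq, e r hr] using h.plane₁ p hp q hq r hr
  plane₂ p hp q hq r hr := by
    simpa only [e p hp, e q hq, e r hr] using h.plane₂ p hp q hq r hr
  cross_pair p hp q hq r hr := by
    simpa only [e p hp, e q hq, e r hr] using h.cross_pair p hp q hq r hr
  cross_self₁ p hp q hq := by simpa only [e p hp, e q hq] using h.cross_self₁ p hp q hq
  cross_self₂ p hp q hq := by simpa only [e p hp, e q hq] using h.cross_self₂ p hp q hq
  cross_self₃ p hp q hq := by simpa only [e p hp, e q hq] using h.cross_self₃ p hp q hq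
  cross_plane₁ a ha p hp q hq r hr := by
    simpa only [e a ha, e p hp, e q hq, e r hr] using h.cross_plane₁ a ha p hp q hq r hr
  cross_plane₂ a ha p hp q hq r hr := by
    simpa only [e a ha, e p hp, e q hq, e r hr] using h.cross_plane₂ a ha p hp q hq r hr

lemma IsGeneric.cross_ne_zero (h : IsGeneric G S g) {p q : V} (hp : p ∈ S) (hq : q ∈ S)
    (hpq : p ≠ q) : g p ⨯₃ g q ≠ 0 := by
  intro h0
  have h1 : g p ⨯₃ g q ⬝ᵥ g p ⨯₃ g q = 0 := by rw [h0, zero_dotProduct]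
  rw [cross_dot_cross, h.unit p hp, h.unit q hq, dotProduct_comm (g q)] at h1
  exact h.pair p hp q hq hpq (by linarith)

/-- If `v` has a neighbour in `S`, the axis is the vector of that neighbour. -/
lemma exists_isGenericAxis [Finite V] (h : IsGeneric G S g) (h1 : G.degIn S v ≤ 1)
    (h2 : ∀ p ∈ S, G.Adj v p → G.degIn S p ≤ 1) : ∃ b, IsGenericAxis G S g v b := by
  by_cases hβ : ∃ β ∈ S, G.Adj v β
  · obtain ⟨β, hβ, hvβ⟩ := hβ
    have hne : ∀ {p}, ¬ G.Adj v p → β ≠ p := fun hp he => hp (he ▸ hvβ)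
    refine ⟨g β, h.unit β hβ, ?_, ?_, ?_, ?_, ?_⟩
    · intro p hp hvp
      rw [card_le_one.1 h1 p (by simp [hp, hvp]) β (by simp [hβ, hvβ])]
    · intro p hp hvp
      exact h.cross_ne_zero hβ hp (hne hvp)
    · intro p hp q hq hpq hvp hvq
      exact h.triple β hβ p hp q hq (hne hvp) (hne hvq) hpq
    · intro p hp q hq hpq hbp hbq
      have key : ∀ p ∈ S, g β ⬝ᵥ g p = 0 → G.Adj β p := by
        intro p hp hbp
        by_contra hc
        refine h.nadj β hβ p hp ?_ hc hbp
        rintro rfl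
        rw [h.unit _ hβ] at hbp
        exact one_ne_zero hbp
      exact hpq (card_le_one.1 (h2 β hβ hvβ) p (by simp [hp, key p hp hbp]) q
        (by simp [hq, key q hq hbq]))
    · intro w _ _ p hp q hq r hr h3 h4 h5 a1 a2 a3
      exact h.plane β hβ p hp q hq r hr (hne a1) (hne a2) (hne a3) h3 h4 h5
  · push Not at hβ
    -- without placed neighbours, any axis in general position will do
    choose! n hn1 hn2 using fun p => exists_perp_unit (g p)
    have hn0 : ∀ p, n p ≠ 0 := fun p h0 => by have := hn1 p; simp [h0] at this
    have hg0 : ∀ p ∈ S, g p ≠ 0 := fun p hp h0 => by have := h.unit p hp; simp [h0] at this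
    obtain ⟨b, hb, hb'⟩ := exists_unit_dot_ne_zero
      (ι := S ⊕ S ⊕ {pq : S × S // pq.1 ≠ pq.2})
      (fun i => match i with
        | .inl p => n p
        | .inr (.inl p) => g p
        | .inr (.inr pq) => g pq.1.1 ⨯₃ g pq.1.2) (by
        rintro (p | p | pq)
        · exact hn0 _
        · exact hg0 _ p.2
        · exact h.cross_ne_zero pq.1.1.2 pq.1.2.2 (fun h0 => pq.2 (Subtype.ext h0)))
    have hbg : ∀ p ∈ S, b ⬝ᵥ g p ≠ 0 := fun p hp => hb' (.inr (.inl ⟨p, hp⟩))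
    refine ⟨b, hb, fun p hp hvp => absurd hvp (hβ p hp), ?_, ?_, ?_, ?_⟩
    · intro p hp _ h0
      have h3 := eq_smul_of_cross_eq_zero hb h0
      have h4 := hb' (.inl ⟨p, hp⟩)
      have h5 := hn2 p
      rw [h3, smul_dotProduct, smul_eq_mul] at h5
      exact (mul_ne_zero (hbg p hp) h4) h5
    · intro p hp q hq hpq _ _
      exact hb' (.inr (.inr ⟨(⟨p, hp⟩, ⟨q, hq⟩), fun h0 => hpq (congrArg Subtype.val h0)⟩))
    · intro p hp _ _ _ h0
      exact (hbg p hp h0).elim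
    · intro w hw h0
      exact (hbg w hw h0).elim

/-- A forest of maximum degree two has an orthogonal representation in general position: vertices
are added one by one, each with at most one neighbour among its predecessors. -/
lemma exists_isGeneric [Finite V] (S : Finset V)
    (hT : ∀ T ⊆ S, T.Nonempty → ∃ v ∈ T, G.degIn T v ≤ 1) (h2 : ∀ v ∈ S, G.degIn S v ≤ 2) :
    ∃ g, IsGeneric G S g := by
  induction S using Finset.strongInduction with
  | H S ih =>
  by_cases hS : S = ∅
  · subst hS
    exact ⟨fun _ => 0, by constructor <;> simp⟩
  obtain ⟨v, hv, hv1⟩ := hT S subset_rfl (nonempty_iff_ne_empty.2 hS)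
  obtain ⟨g, hg⟩ := ih _ (erase_ssubset hv) (fun T h => hT T (h.trans (erase_subset v S)))
    (fun u hu => (degIn_mono G (erase_subset v S) u).trans (h2 u (mem_of_mem_erase hu)))
  obtain ⟨b, hb⟩ := exists_isGenericAxis hg (v := v)
    ((degIn_mono G (erase_subset v S) v).trans hv1) (fun p hp hvp => by
      have := h2 p (mem_of_mem_erase hp)
      rw [degIn_erase hv, if_pos hvp.symm] at this
      omega)
  obtain ⟨u, hu⟩ := exists_isGenericStep hg hb
  have e : ∀ p ∈ S.erase v, Function.update g v u p = g p := fun p hp =>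
    Function.update_of_ne (ne_of_mem_erase hp) _ _
  have := (hg.congr e).insert (v := v) (by
    rw [Function.update_self]
    exact hu.congr e)
  rw [insert_erase hv] at this
  exact ⟨_, this⟩

end GenericExistence

/-! ### Planes through points of the sphere -/

section SphereVectors
open Matrix

/-- The plane `n · x = 1` through `a`, `b`, `c` determines `n`, by Cramer's rule. -/
lemma tripleProd_smul_eq {n a b c : Fin 3 → ℝ} (ha : n ⬝ᵥ a = 1) (hb : n ⬝ᵥ b = 1)
    (hc : n ⬝ᵥ c = 1) : tripleProd a b c • n = planeNormal a b c := by
  have h : ∀ n a b c : Fin 3 → ℝ, tripleProd a b c • n =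
      (n ⬝ᵥ a) • b ⨯₃ c + (n ⬝ᵥ b) • c ⨯₃ a + (n ⬝ᵥ c) • a ⨯₃ b := by
    intro n a b c
    ext i
    fin_cases i <;>
      simp only [tripleProd, dot3, Pi.add_apply, Pi.smul_apply, smul_eq_mul, Fin.zero_eta, Fin.mk_one,
        Fin.reduceFinMk, cross0, cross1, cross2] <;> ring
  rw [h, ha, hb, hc]
  simp only [one_smul, planeNormal]
  abel

lemma exists_dot_eq_one {a b c : Fin 3 → ℝ} (h : tripleProd a b c ≠ 0) :
    ∃ n : Fin 3 → ℝ, n ⬝ᵥ a = 1 ∧ n ⬝ᵥ b = 1 ∧ n ⬝ᵥ c = 1 := by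
  have key : ∀ a b c : Fin 3 → ℝ, tripleProd a b c ≠ 0 →
      ((tripleProd a b c)⁻¹ • planeNormal a b c) ⬝ᵥ a = 1 := fun a b c h => by
    rw [smul_dotProduct, dotProduct_comm, planeNormal_dot, smul_eq_mul, inv_mul_cancel₀ h]
  refine ⟨(tripleProd a b c)⁻¹ • planeNormal a b c, key a b c h, ?_, ?_⟩
  · rw [← tripleProd_rot, ← planeNormal_rot]
    exact key b c a (by rwa [tripleProd_rot])
  · rw [← tripleProd_rot, ← planeNormal_rot, ← tripleProd_rot, ← planeNormal_rot]
    exact key c a b (by rwa [tripleProd_rot, tripleProd_rot])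

/-- A unit normal avoiding finitely many pairwise non-opposite unit vectors. -/
lemma exists_normal_avoiding {V : Type*} {S : Finset V} {g : V → Fin 3 → ℝ}
    (hu : ∀ p ∈ S, g p ⬝ᵥ g p = 1) (hp : ∀ p ∈ S, ∀ q ∈ S, p ≠ q → (g p ⬝ᵥ g q) ^ 2 ≠ 1)
    {m : Fin 3 → ℝ} (hm : m ≠ 0) :
    ∃ c : ℝ, c ≠ 0 ∧ (c • m) ⬝ᵥ (c • m) = 1 ∧ ∀ q ∈ S, g q ≠ c • m := by
  obtain ⟨c, hc, hcm⟩ := exists_smul_unit hm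
  by_cases h : ∃ q ∈ S, g q = c • m
  · obtain ⟨q, hq, hqm⟩ := h
    refine ⟨-c, neg_ne_zero.2 hc, by simpa using hcm, fun p hp' hpm => ?_⟩
    rw [neg_smul, ← hqm] at hpm
    by_cases hpq : p = q
    · subst hpq
      have h1 := hu p hp'
      have h2 : g p = 0 := self_eq_neg.1 hpm
      rw [h2, zero_dotProduct] at h1
      exact zero_ne_one h1
    · apply hp p hp' q hq hpq
      rw [hpm, neg_dotProduct, hu q hq]; norm_num
  · push Not at h
    exact ⟨c, hc, hcm, h⟩

end SphereVectors

/-! ### Placing a part of degree two on the sphere -/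

section SpherePart
open Finset Matrix
open scoped Classical

variable {V : Type*} {G : SimpleGraph V}

/-- `R` contains one vertex from each cycle of `U`, called a closer, and `g` places the remaining
forest in general position. A closer `r` has exactly two neighbours `v r` and `w r` in `U`, so its
unit vector is forced up to sign to be `c r • g (v r) × g (w r)`; the sign is chosen so that this
vector is new. The conditions `deg_v`, `deg_next` and `unique` are what is used of the fact that the
vertices near a closer lie on its cycle. -/
structure IsClosing (G : SimpleGraph V) (U R : Finset V) (g : V → Fin 3 → ℝ)
    (v w : V → V) (c : V → ℝ) : Prop where
  subset : R ⊆ U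
  generic : IsGeneric G (U \ R) g
  deg : ∀ r ∈ R, G.degIn U r = 2
  v_mem : ∀ r ∈ R, v r ∈ U \ R
  w_mem : ∀ r ∈ R, w r ∈ U \ R
  ne : ∀ r ∈ R, v r ≠ w r
  adj_iff : ∀ r ∈ R, ∀ u ∈ U, G.Adj r u ↔ u = v r ∨ u = w r
  deg_v : ∀ r ∈ R, ∀ u ∈ U, G.Adj r u → G.degIn U u = 2
  deg_next : ∀ r ∈ R, ∀ u ∈ U, G.Adj r u → ∀ t ∈ U, G.Adj u t → G.degIn U t = 2
  unique : ∀ u ∈ U, ∀ r ∈ R, ∀ r' ∈ R, G.Adj u r → G.Adj u r' → r = r'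
  scale : ∀ r ∈ R, c r ≠ 0
  unit : ∀ r ∈ R, (c r • g (v r) ⨯₃ g (w r)) ⬝ᵥ (c r • g (v r) ⨯₃ g (w r)) = 1
  avoid : ∀ r ∈ R, ∀ q ∈ U \ R, g q ≠ c r • g (v r) ⨯₃ g (w r)

lemma exists_isClosing [Finite V] (U : Finset V) (h2 : ∀ u ∈ U, G.degIn U u ≤ 2) :
    ∃ R g v w c, IsClosing G U R g v w c := by
  obtain ⟨R, hR, ha, hb, hc, hd⟩ := exists_closers U h2
  obtain ⟨g, hg⟩ := exists_isGeneric (U \ R) hd fun u hu =>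
    (degIn_mono G sdiff_subset u).trans (h2 u (mem_sdiff.1 hu).1)
  have h1 : ∀ r, ∃ v w, r ∈ R → v ≠ w ∧ v ∈ U \ R ∧ w ∈ U \ R ∧
      ∀ u ∈ U, G.Adj r u ↔ u = v ∨ u = w := by
    intro r
    by_cases hr : r ∈ R
    · obtain ⟨v, w, hvw, hS⟩ := card_eq_two.1 (ha r hr)
      have hiff : ∀ u, (u ∈ U ∧ G.Adj r u) ↔ u = v ∨ u = w := fun u => by
        rw [← mem_filter, hS]; simp
      have hv := (hiff v).2 (Or.inl rfl)
      have hw := (hiff w).2 (Or.inr rfl)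
      refine ⟨v, w, fun _ => ⟨hvw, mem_sdiff.2 ⟨hv.1, (hb r hr v hv.1 hv.2).1⟩,
        mem_sdiff.2 ⟨hw.1, (hb r hr w hw.1 hw.2).1⟩, fun u hu => ?_⟩⟩
      rw [← hiff]; simp [hu]
    · exact ⟨r, r, fun h => absurd h hr⟩
  choose v w hvw using h1
  have h3 : ∀ r, ∃ c : ℝ, r ∈ R → c ≠ 0 ∧
      (c • g (v r) ⨯₃ g (w r)) ⬝ᵥ (c • g (v r) ⨯₃ g (w r)) = 1 ∧
      ∀ q ∈ U \ R, g q ≠ c • g (v r) ⨯₃ g (w r) := by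
    intro r
    by_cases hr : r ∈ R
    · obtain ⟨h4, h5, h6, -⟩ := hvw r hr
      obtain ⟨c, hc⟩ := exists_normal_avoiding hg.unit hg.pair (hg.cross_ne_zero h5 h6 h4)
      exact ⟨c, fun _ => hc⟩
    · exact ⟨0, fun h => absurd h hr⟩
  choose c hc' using h3
  exact ⟨R, g, v, w, c, hR, hg, ha, fun r hr => (hvw r hr).2.1, fun r hr => (hvw r hr).2.2.1,
    fun r hr => (hvw r hr).1, fun r hr => (hvw r hr).2.2.2,
    fun r hr u hu hru => (hb r hr u hu hru).2.1, fun r hr u hu hru => (hb r hr u hu hru).2.2,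
    hc, fun r hr => (hc' r hr).1, fun r hr => (hc' r hr).2.1, fun r hr => (hc' r hr).2.2⟩

/-- The placement of the forest by `g`, extended to the closers. -/
noncomputable def closingMap (R : Finset V) (g : V → Fin 3 → ℝ) (v w : V → V) (c : V → ℝ)
    (u : V) : Fin 3 → ℝ :=
  if u ∈ R then c u • g (v u) ⨯₃ g (w u) else g u

/-- The combinatorial properties, for a part `U` of dimension three and the exceptional part `X` of
an optimal partition, on which the placement of `U` on a sphere relies. -/
structure IsSpherePart (G : SimpleGraph V) (U X : Finset V) : Prop where
  deg_le : ∀ u ∈ U, G.degIn U u ≤ 2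
  deg_add_le : ∀ u ∈ U, G.degIn U u + G.degIn X u ≤ 3
  deg_eq : ∀ x ∈ X, G.degIn U x = 3
  disj : Disjoint U X
  exchange : ∀ D ⊆ X, ∀ A ⊆ U, (∀ a ∈ A, ∀ b ∈ A, ¬ G.Adj a b) →
    (∀ a ∈ A, 3 ≤ G.degIn (U ∪ D) a) → #A ≤ #D

variable {U X R : Finset V} {g : V → Fin 3 → ℝ} {v w : V → V} {c : V → ℝ}

namespace IsClosing

lemma map_of_mem {r : V} (hr : r ∈ R) :
    closingMap R g v w c r = c r • g (v r) ⨯₃ g (w r) := if_pos hr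

lemma map_of_notMem {u : V} (hu : u ∉ R) : closingMap R g v w c u = g u := if_neg hu

lemma map_of_sdiff {u : V} (hu : u ∈ U \ R) : closingMap R g v w c u = g u :=
  if_neg (mem_sdiff.1 hu).2

lemma mem_cases (_h : IsClosing G U R g v w c) {u : V} (hu : u ∈ U) : u ∈ R ∨ u ∈ U \ R := by
  by_cases h : u ∈ R
  · exact Or.inl h
  · exact Or.inr (mem_sdiff.2 ⟨hu, h⟩)

lemma map_unit (h : IsClosing G U R g v w c) {u : V} (hu : u ∈ U) :
    closingMap R g v w c u ⬝ᵥ closingMap R g v w c u = 1 := by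
  rcases h.mem_cases hu with hr | hr
  · rw [map_of_mem hr]; exact h.unit u hr
  · rw [map_of_sdiff hr]; exact h.generic.unit u hr

lemma map_adj (h : IsClosing G U R g v w c) {p q : V} (hp : p ∈ U) (hq : q ∈ U)
    (hpq : G.Adj p q) : closingMap R g v w c p ⬝ᵥ closingMap R g v w c q = 0 := by
  have key : ∀ {p q}, p ∈ R → q ∈ U → G.Adj p q →
      closingMap R g v w c p ⬝ᵥ closingMap R g v w c q = 0 := by
    intro p q hp hq hpq
    rw [map_of_mem hp]
    rcases (h.adj_iff p hp q hq).1 hpq with rfl | rfl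
    · rw [map_of_sdiff (h.v_mem p hp), smul_dotProduct, dotProduct_comm, dot_self_cross, smul_zero]
    · rw [map_of_sdiff (h.w_mem p hp), smul_dotProduct, dotProduct_comm, dot_cross_self, smul_zero]
  rcases h.mem_cases hp with hp' | hp'
  · exact key hp' hq hpq
  rcases h.mem_cases hq with hq' | hq'
  · rw [dotProduct_comm]; exact key hq' hp hpq.symm
  rw [map_of_sdiff hp', map_of_sdiff hq']
  exact h.generic.adj p hp' q hq' hpq

lemma map_inj (h : IsClosing G U R g v w c) {p q : V} (hp : p ∈ U) (hq : q ∈ U)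
    (hpq : closingMap R g v w c p = closingMap R g v w c q) : p = q := by
  rcases h.mem_cases hp with hp' | hp' <;> rcases h.mem_cases hq with hq' | hq'
  · rw [map_of_mem hp', map_of_mem hq'] at hpq
    by_contra hne
    -- otherwise the neighbour `v q` would lie in the plane of `v p` and `w p`
    have hvq := h.v_mem q hq'
    have hqv : G.Adj q (v q) := (h.adj_iff q hq' _ (mem_sdiff.1 hvq).1).2 (Or.inl rfl)
    have hnadj : ¬ G.Adj p (v q) := fun hc =>
      hne (h.unique _ (mem_sdiff.1 hvq).1 p hp' q hq' hc.symm hqv.symm)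
    rw [h.adj_iff p hp' _ (mem_sdiff.1 hvq).1, not_or] at hnadj
    apply h.generic.triple _ hvq _ (h.v_mem p hp') _ (h.w_mem p hp') hnadj.1 hnadj.2 (h.ne p hp')
    have h1 := congrArg (fun t => g (v q) ⬝ᵥ t) hpq
    simp only [dotProduct_smul, dot_self_cross, smul_eq_mul, mul_zero] at h1
    exact (mul_eq_zero.1 h1).resolve_left (h.scale p hp')
  · rw [map_of_mem hp', map_of_sdiff hq'] at hpq
    exact absurd hpq.symm (h.avoid p hp' q hq')
  · rw [map_of_sdiff hp', map_of_mem hq'] at hpq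
    exact absurd hpq (h.avoid q hq' p hp')
  · rw [map_of_sdiff hp', map_of_sdiff hq'] at hpq
    by_contra hne
    apply h.generic.pair p hp' q hq' hne
    rw [hpq, h.generic.unit q hq']; norm_num

/-- A vertex whose degree in `U` is not two is neither equal nor adjacent to a neighbour of a
closer. -/
lemma far (h : IsClosing G U R g v w c) {r y : V} (hr : r ∈ R) (hy : y ∈ U)
    (hdeg : G.degIn U y ≠ 2) :
    v r ≠ y ∧ w r ≠ y ∧ ¬ G.Adj (v r) y ∧ ¬ G.Adj (w r) y := by
  have hv := (mem_sdiff.1 (h.v_mem r hr)).1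
  have hw := (mem_sdiff.1 (h.w_mem r hr)).1
  have hrv := (h.adj_iff r hr _ hv).2 (Or.inl rfl)
  have hrw := (h.adj_iff r hr _ hw).2 (Or.inr rfl)
  exact ⟨fun e => hdeg (e ▸ h.deg_v r hr _ hv hrv), fun e => hdeg (e ▸ h.deg_v r hr _ hw hrw),
    fun e => hdeg (h.deg_next r hr _ hv hrv y hy e), fun e => hdeg (h.deg_next r hr _ hw hrw y hy e)⟩

end IsClosing

namespace IsSpherePart

/-- Two nonadjacent neighbours of `x` of degree two could be exchanged for `x`, against the choice
of the partition. -/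
lemma adj_of_deg_two (hU : IsSpherePart G U X) {x a b : V} (hx : x ∈ X) (ha : a ∈ U) (hb : b ∈ U)
    (hxa : G.Adj x a) (hxb : G.Adj x b) (hab : a ≠ b) (ha2 : G.degIn U a = 2)
    (hb2 : G.degIn U b = 2) : G.Adj a b := by
  by_contra hc
  have hd : Disjoint U {x} := by
    rw [disjoint_singleton_right]
    exact fun h => (disjoint_left.1 hU.disj h hx)
  have := hU.exchange {x} (by simpa using hx) {a, b} (by simp [insert_subset_iff, ha, hb])
    (by simp [hc, G.adj_comm b a]) (by
      simp only [mem_insert, mem_singleton, forall_eq_or_imp, forall_eq]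
      rw [degIn_union G hd, degIn_union G hd, degIn_singleton_of_adj hxa.symm,
        degIn_singleton_of_adj hxb.symm]
      omega)
  rw [card_pair hab, card_singleton] at this
  omega

variable (hU : IsSpherePart G U X) (h : IsClosing G U R g v w c)
include hU h

/-- A vertex of `X` has at most one closer among its neighbours. -/
lemma notMem_closers {x r y : V} (hx : x ∈ X) (hr : r ∈ R) (hy : y ∈ U) (hxr : G.Adj x r)
    (hxy : G.Adj x y) (hry : r ≠ y) : y ∉ R := by
  intro hyR
  have hadj := hU.adj_of_deg_two hx (h.subset hr) hy hxr hxy hry (h.deg r hr) (h.deg y hyR)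
  rcases (h.adj_iff r hr y hy).1 hadj with rfl | rfl
  · exact (mem_sdiff.1 (h.v_mem r hr)).2 hyR
  · exact (mem_sdiff.1 (h.w_mem r hr)).2 hyR

lemma near_or_far {x r y : V} (hx : x ∈ X) (hr : r ∈ R) (hy : y ∈ U) (hxr : G.Adj x r)
    (hxy : G.Adj x y) (hry : r ≠ y) : y = v r ∨ y = w r ∨
      (v r ≠ y ∧ w r ≠ y ∧ ¬ G.Adj (v r) y ∧ ¬ G.Adj (w r) y) := by
  by_cases hdeg : G.degIn U y = 2
  · rcases (h.adj_iff r hr y hy).1 (hU.adj_of_deg_two hx (h.subset hr) hy hxr hxy hry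
      (h.deg r hr) hdeg) with h1 | h1
    · exact Or.inl h1
    · exact Or.inr (Or.inl h1)
  · exact Or.inr (Or.inr (h.far hr hy hdeg))

lemma tripleProd_closer_ne_zero {x r y z : V} (hx : x ∈ X) (hr : r ∈ R) (hy : y ∈ U) (hz : z ∈ U)
    (hxr : G.Adj x r) (hxy : G.Adj x y) (hxz : G.Adj x z) (hry : r ≠ y) (hrz : r ≠ z)
    (hyz : y ≠ z) : tripleProd (closingMap R g v w c r) (closingMap R g v w c y)
      (closingMap R g v w c z) ≠ 0 := by
  have hyR := hU.notMem_closers h hx hr hy hxr hxy hry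
  have hzR := hU.notMem_closers h hx hr hz hxr hxz hrz
  have hy' : y ∈ U \ R := mem_sdiff.2 ⟨hy, hyR⟩
  have hz' : z ∈ U \ R := mem_sdiff.2 ⟨hz, hzR⟩
  have hv := h.v_mem r hr
  have hw := h.w_mem r hr
  have hvw := h.ne r hr
  have hg := h.generic
  rw [IsClosing.map_of_mem hr, IsClosing.map_of_notMem hyR, IsClosing.map_of_notMem hzR,
    tripleProd, smul_dotProduct, smul_eq_mul]
  refine mul_ne_zero (h.scale r hr) ?_
  have hself : g (v r) ⨯₃ g (w r) ⬝ᵥ g (v r) ⨯₃ g (w r) ≠ 0 := fun h0 =>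
    hg.cross_ne_zero hv hw hvw (dot_self_eq_zero3 h0)
  have hv1 : ∀ {t}, t ∈ U \ R → (v r ≠ t ∧ w r ≠ t ∧ ¬ G.Adj (v r) t ∧ ¬ G.Adj (w r) t) →
      g (v r) ⨯₃ g (w r) ⬝ᵥ g (v r) ⨯₃ g t ≠ 0 := by
    intro t ht ⟨f1, f2, f3, f4⟩ h0
    rw [cross_dot_cross, hg.unit _ hv, dotProduct_comm (g (w r)) (g (v r))] at h0
    exact hg.cross_self _ hv _ hw t ht hvw f1 f2 f3 f4 (by linarith)
  have hw1 : ∀ {t}, t ∈ U \ R → (v r ≠ t ∧ w r ≠ t ∧ ¬ G.Adj (v r) t ∧ ¬ G.Adj (w r) t) →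
      g (v r) ⨯₃ g (w r) ⬝ᵥ g (w r) ⨯₃ g t ≠ 0 := by
    intro t ht ⟨f1, f2, f3, f4⟩ h0
    rw [cross_dot_cross, hg.unit _ hw] at h0
    exact hg.cross_self _ hw _ hv t ht hvw.symm f2 f1 f4 f3 (by
      rw [dotProduct_comm (g (w r)) (g (v r))]; linarith)
  rcases hU.near_or_far h hx hr hy hxr hxy hry with e1 | e1 | e1 <;>
    rcases hU.near_or_far h hx hr hz hxr hxz hrz with e2 | e2 | e2
  · exact absurd (e1.trans e2.symm) hyz
  · rw [e1, e2]; exact hself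
  · rw [e1]; exact hv1 hz' e2
  · rw [e1, e2, ← cross_anticomm (g (v r)) (g (w r)), dotProduct_neg, neg_ne_zero]; exact hself
  · exact absurd (e1.trans e2.symm) hyz
  · rw [e1]; exact hw1 hz' e2
  · rw [e2, ← cross_anticomm (g (v r)) (g y), dotProduct_neg, neg_ne_zero]; exact hv1 hy' e1
  · rw [e2, ← cross_anticomm (g (w r)) (g y), dotProduct_neg, neg_ne_zero]; exact hw1 hy' e1
  · exact hg.cross_pair _ hv _ hw _ hy' _ hz' hvw hyz e1.1 e2.1 e1.2.1 e2.2.1 e1.2.2.1 e2.2.2.1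
      e1.2.2.2 e2.2.2.2

/-- The vectors of the three neighbours of `x ∈ X` are linearly independent. -/
lemma tripleProd_ne_zero {x a b d : V} (hx : x ∈ X) (ha : a ∈ U) (hb : b ∈ U) (hd : d ∈ U)
    (hxa : G.Adj x a) (hxb : G.Adj x b) (hxd : G.Adj x d) (hab : a ≠ b) (had : a ≠ d)
    (hbd : b ≠ d) : tripleProd (closingMap R g v w c a) (closingMap R g v w c b)
      (closingMap R g v w c d) ≠ 0 := by
  by_cases haR : a ∈ R
  · exact hU.tripleProd_closer_ne_zero h hx haR hb hd hxa hxb hxd hab had hbd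
  by_cases hbR : b ∈ R
  · rw [← tripleProd_rot]
    exact hU.tripleProd_closer_ne_zero h hx hbR hd ha hxb hxd hxa hbd hab.symm had.symm
  by_cases hdR : d ∈ R
  · rw [tripleProd_rot]
    exact hU.tripleProd_closer_ne_zero h hx hdR ha hb hxd hxa hxb had.symm hbd.symm hab
  rw [IsClosing.map_of_notMem haR, IsClosing.map_of_notMem hbR, IsClosing.map_of_notMem hdR]
  exact h.generic.triple a (mem_sdiff.2 ⟨ha, haR⟩) b (mem_sdiff.2 ⟨hb, hbR⟩) d
    (mem_sdiff.2 ⟨hd, hdR⟩) hab had hbd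

/-- The neighbours of `x ∈ X` span a plane that avoids the origin. -/
lemma exists_equation {x : V} (hx : x ∈ X) : ∃ n : Fin 3 → ℝ,
    ∀ u ∈ U, G.Adj x u → n ⬝ᵥ closingMap R g v w c u = 1 := by
  obtain ⟨a, b, d, hab, had, hbd, hS⟩ := card_eq_three.1 (hU.deg_eq x hx)
  have hiff : ∀ u, (u ∈ U ∧ G.Adj x u) ↔ u = a ∨ u = b ∨ u = d := fun u => by
    rw [← mem_filter, hS]; simp
  have ha := (hiff a).2 (by simp)
  have hb := (hiff b).2 (by simp)
  have hd := (hiff d).2 (by simp)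
  obtain ⟨n, h1, h2, h3⟩ := exists_dot_eq_one
    (hU.tripleProd_ne_zero h hx ha.1 hb.1 hd.1 ha.2 hb.2 hd.2 hab had hbd)
  refine ⟨n, fun u hu hxu => ?_⟩
  rcases (hiff u).1 ⟨hu, hxu⟩ with rfl | rfl | rfl <;> assumption

end IsSpherePart
end SpherePart

/-! ### Vertices with a common equation -/

section SphereFibre
open Finset Matrix
open scoped Classical

variable {V : Type*} {G : SimpleGraph V} {U X R : Finset V} {g : V → Fin 3 → ℝ} {v w : V → V}
  {c : V → ℝ}

namespace IsClosing

/-- A plane avoiding the origin contains at most three of the vectors `g b`. -/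
lemma card_le_three (h : IsClosing G U R g v w c) {n : Fin 3 → ℝ} {B : Finset V} (hB : B ⊆ U \ R)
    (hn : ∀ b ∈ B, n ⬝ᵥ g b = 1) : #B ≤ 3 := by
  by_contra! hc
  obtain ⟨B', hB', h4⟩ := exists_subset_card_eq hc
  obtain ⟨a, C, ha, rfl, hC⟩ := card_eq_succ.1 h4
  obtain ⟨p, q, r, h1, h2, h3, rfl⟩ := card_eq_three.1 hC
  simp only [mem_insert, mem_singleton, not_or] at ha
  simp only [insert_subset_iff, singleton_subset_iff] at hB'
  obtain ⟨ba, bp, bq, br⟩ := hB'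
  apply h.generic.plane a (hB ba) p (hB bp) q (hB bq) r (hB br) ha.1 ha.2.1 ha.2.2 h1 h2 h3
  rw [← tripleProd_smul_eq (hn p bp) (hn q bq) (hn r br), dotProduct_smul, dotProduct_comm, hn a ba,
    smul_eq_mul, mul_one]

/-- A plane through three vectors `g b` with `b` far from a closer does not contain that closer. -/
lemma closer_notMem_plane (h : IsClosing G U R g v w c) {n : Fin 3 → ℝ} {B : Finset V}
    (hB : B ⊆ U \ R) (hn : ∀ b ∈ B, n ⬝ᵥ g b = 1) (hB3 : #B = 3)
    (hdeg : ∀ b ∈ B, G.degIn U b ≠ 2) {r : V} (hr : r ∈ R) :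
    n ⬝ᵥ closingMap R g v w c r ≠ 1 := by
  intro hnr
  obtain ⟨p, q, s, h1, h2, h3, rfl⟩ := card_eq_three.1 hB3
  simp only [mem_insert, mem_singleton, forall_eq_or_imp, forall_eq] at hn hdeg
  simp only [insert_subset_iff, singleton_subset_iff] at hB
  obtain ⟨bp, bq, bs⟩ := hB
  obtain ⟨p1, p2, p3, p4⟩ := h.far hr (mem_sdiff.1 bp).1 hdeg.1
  obtain ⟨q1, q2, q3, q4⟩ := h.far hr (mem_sdiff.1 bq).1 hdeg.2.1
  obtain ⟨s1, s2, s3, s4⟩ := h.far hr (mem_sdiff.1 bs).1 hdeg.2.2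
  apply h.generic.cross_plane _ (h.v_mem r hr) _ (h.w_mem r hr) p bp q bq s bs (h.ne r hr)
    h1 h2 h3 p1 q1 s1 p2 q2 s2 p3 q3 s3 p4 q4 s4
  rw [← tripleProd_smul_eq hn.1 hn.2.1 hn.2.2, dotProduct_smul]
  have hu := h.unit r hr
  rw [map_of_mem hr, dotProduct_smul, dotProduct_comm] at hnr
  rw [smul_dotProduct, dotProduct_smul] at hu
  simp only [smul_eq_mul] at hnr hu ⊢
  generalize g (v r) ⨯₃ g (w r) ⬝ᵥ n = α at *
  generalize g (v r) ⨯₃ g (w r) ⬝ᵥ g (v r) ⨯₃ g (w r) = β at *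
  have hβ : β = α ^ 2 := by
    have : (c r) ^ 2 * (β - α ^ 2) = 0 := by linear_combination hu - (c r * α + 1) * hnr
    exact sub_eq_zero.1 ((mul_eq_zero.1 this).resolve_left (pow_ne_zero 2 (h.scale r hr)))
  rw [hβ]; ring

end IsClosing

namespace IsSpherePart

lemma not_adj_of_degIn_eq_three (hU : IsSpherePart G U X) {a b : V} (ha : a ∈ U) (hb : b ∈ U)
    (h3 : 3 ≤ G.degIn X a) : ¬ G.Adj a b := fun hab => by
  have h1 := hU.deg_add_le a ha
  have h2 : 0 < G.degIn U a := degIn_pos_iff.2 ⟨b, hb, hab⟩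
  omega

/-- Three vertices of `X` with a common equation have the same neighbours in `U`. The forest
vertices among these neighbours form a set `B` of at most three elements, as no four vectors of the
forest are coplanar. If there are no closers among the neighbours, then `B` is the neighbourhood of
each of the three. Otherwise, an exchange argument and double counting show that every vertex of `B`
has at least two neighbours in `T`, hence at most one in `U`; so `B` is far from the closers, and
its plane contains none of their vectors. -/
lemma adj_of_equation (hU : IsSpherePart G U X) (h : IsClosing G U R g v w c) {T : Finset V}
    (hT : T ⊆ X) (hT3 : #T = 3) {n : Fin 3 → ℝ}
    (hn : ∀ x ∈ T, ∀ u ∈ U, G.Adj x u → n ⬝ᵥ closingMap R g v w c u = 1) {x y u : V}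
    (hx : x ∈ T) (hy : y ∈ T) (hu : u ∈ U) (hxu : G.Adj x u) : G.Adj y u := by
  set B := {b ∈ U \ R | 0 < G.degIn T b} with hBdef
  set C := {r ∈ R | 0 < G.degIn T r} with hCdef
  have hBU : B ⊆ U \ R := filter_subset _ _
  have hBn : ∀ b ∈ B, n ⬝ᵥ g b = 1 := by
    intro b hb
    obtain ⟨x, hx, hbx⟩ := degIn_pos_iff.1 (mem_filter.1 hb).2
    have := hn x hx b (mem_sdiff.1 (hBU hb)).1 hbx.symm
    rwa [IsClosing.map_of_sdiff (hBU hb)] at this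
  have hB3 := h.card_le_three hBU hBn
  -- `C` is the set of closers adjacent to a vertex of `T`
  have hC : C = ∅ := by
    by_contra hne
    obtain ⟨r, hr⟩ := nonempty_iff_ne_empty.2 hne
    obtain ⟨hrR, hr0⟩ := mem_filter.1 hr
    obtain ⟨x', hx', hrx'⟩ := degIn_pos_iff.1 hr0
    -- the vertices of `F` and `C` could be exchanged for those of `T`
    set F := {b ∈ B | G.degIn T b = 3} with hFdef
    have hFB : F ⊆ B := filter_subset _ _
    have hF3 : ∀ b ∈ F, 3 ≤ G.degIn X b := fun b hb =>
      (mem_filter.1 hb).2.symm.le.trans (degIn_mono G hT b)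
    have hBU' : B ⊆ U := hBU.trans sdiff_subset
    have hCU : C ⊆ U := (filter_subset _ _).trans h.subset
    have hCR : ∀ r ∈ C, r ∈ R := fun r hr => (mem_filter.1 hr).1
    have hdisj : Disjoint C F := disjoint_left.2 fun a ha hb =>
      (mem_sdiff.1 (hBU (hFB hb))).2 (hCR a ha)
    have hC1 : ∀ r ∈ C, G.degIn T r ≤ 1 := fun r hr => by
      have h1 := hU.deg_add_le r (hCU hr)
      have h2 := degIn_mono G hT r
      have h3 := h.deg r (hCR r hr)
      omega
    have hUT : Disjoint U T := hU.disj.mono_right hT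
    have hCF : #C + #F ≤ 3 := by
      rw [← card_union_of_disjoint hdisj, ← hT3]
      refine hU.exchange T hT (C ∪ F) (union_subset hCU (hFB.trans hBU')) ?_ ?_
      · intro a ha b hb hab
        have haU := union_subset hCU (hFB.trans hBU') ha
        have hbU := union_subset hCU (hFB.trans hBU') hb
        rcases mem_union.1 ha with ha | ha
        · rcases mem_union.1 hb with hb | hb
          · rcases (h.adj_iff a (hCR a ha) b hbU).1 hab with e | e
            · exact (mem_sdiff.1 (h.v_mem a (hCR a ha))).2 (e ▸ hCR b hb)
            · exact (mem_sdiff.1 (h.w_mem a (hCR a ha))).2 (e ▸ hCR b hb)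
          · exact hU.not_adj_of_degIn_eq_three hbU haU (hF3 b hb) hab.symm
        · exact hU.not_adj_of_degIn_eq_three haU hbU (hF3 a ha) hab
      · intro a ha
        rw [degIn_union G hUT]
        rcases mem_union.1 ha with ha | ha
        · have h1 := h.deg a (hCR a ha)
          have h2 := (mem_filter.1 ha).2
          omega
        · have := (mem_filter.1 ha).2
          omega
    -- the edges between `T` and `U` are counted from both sides
    have hsum : ∑ b ∈ B, G.degIn T b + ∑ r ∈ C, G.degIn T r = 9 := by
      have h1 : ∑ u ∈ U, G.degIn T u = 9 := by
        rw [← sum_degIn_comm, sum_congr rfl fun x hx => hU.deg_eq x (hT hx), sum_const, hT3]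
        rfl
      rw [← h1, ← sum_sdiff h.subset, hBdef, hCdef]
      congr 1
      · refine sum_subset (filter_subset _ _) fun a ha hna => ?_
        simpa [ha] using hna
      · refine sum_subset (filter_subset _ _) fun a ha hna => ?_
        simpa [ha] using hna
    have hsumC : ∑ r ∈ C, G.degIn T r ≤ #C := by
      simpa using sum_le_sum hC1
    have hpt : ∀ b ∈ B, G.degIn T b ≤ 2 + if b ∈ F then 1 else 0 := by
      intro b hb
      have := degIn_le_card (G := G) T b
      split_ifs with hbF
      · omega
      · have : G.degIn T b ≠ 3 := fun h => hbF (mem_filter.2 ⟨hb, h⟩)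
        omega
    have hsumF : ∀ S ⊆ B, ∑ b ∈ S, G.degIn T b ≤ 2 * #S + #(S ∩ F) := by
      intro S hS
      refine (sum_le_sum fun b hb => hpt b (hS hb)).trans_eq ?_
      rw [sum_add_distrib, sum_const, smul_eq_mul, mul_comm, ← card_filter, filter_mem_eq_inter]
    have hcardF : ∀ S : Finset V, #(S ∩ F) ≤ #F := fun S => card_le_card inter_subset_right
    have hB3' : #B = 3 := by
      have h1 := hsumF B Subset.rfl
      have h2 := hcardF B
      omega
    have hB2 : ∀ b ∈ B, 2 ≤ G.degIn T b := by
      intro b hb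
      by_contra! hlt
      have h1 := hsumF (B.erase b) (erase_subset _ _)
      have h2 := hcardF (B.erase b)
      have h3 := add_sum_erase B (fun b => G.degIn T b) hb
      have h4 := card_erase_of_mem hb
      omega
    refine h.closer_notMem_plane hBU hBn hB3' (fun b hb => ?_) hrR
      (hn x' hx' r (h.subset hrR) hrx'.symm)
    have h1 := hU.deg_add_le b (hBU' hb)
    have h2 := hB2 b hb
    have h3 := degIn_mono G hT b
    omega
  have hN : ∀ z ∈ T, {u ∈ U | G.Adj z u} = B := by
    intro z hz
    refine eq_of_subset_of_card_le (fun u hu => ?_) (hB3.trans (hU.deg_eq z (hT hz)).symm.le)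
    obtain ⟨huU, hzu⟩ := mem_filter.1 hu
    have h0 : 0 < G.degIn T u := degIn_pos_iff.2 ⟨z, hz, hzu.symm⟩
    rcases h.mem_cases huU with huR | huR
    · have : u ∈ C := mem_filter.2 ⟨huR, h0⟩
      rw [hC] at this
      exact absurd this (notMem_empty u)
    · exact mem_filter.2 ⟨huR, h0⟩
  have : u ∈ ({u ∈ U | G.Adj y u} : Finset V) := by
    rw [hN y hy, ← hN x hx]
    exact mem_filter.2 ⟨hu, hxu⟩
  exact (mem_filter.1 this).2

/-- A placement of `U` on the unit sphere such that three vertices of `X` share an equation only if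
they have the same neighbours in `U`. -/
lemma exists_placement [Finite V] (hU : IsSpherePart G U X) : ∃ g n : V → Fin 3 → ℝ,
    (∀ u ∈ U, g u ⬝ᵥ g u = 1) ∧ Set.InjOn g U ∧
    (∀ p ∈ U, ∀ q ∈ U, G.Adj p q → g p ⬝ᵥ g q = 0) ∧
    (∀ x ∈ X, ∀ u ∈ U, G.Adj x u → n x ⬝ᵥ g u = 1) ∧
    ∀ T ⊆ X, #T = 3 → (∀ x ∈ T, ∀ y ∈ T, n x = n y) →
      ∀ x ∈ T, ∀ y ∈ T, ∀ u ∈ U, G.Adj x u → G.Adj y u := by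
  obtain ⟨R, g, v, w, c, h⟩ := exists_isClosing U hU.deg_le
  have h1 : ∀ x, ∃ n : Fin 3 → ℝ, x ∈ X →
      ∀ u ∈ U, G.Adj x u → n ⬝ᵥ closingMap R g v w c u = 1 := by
    intro x
    by_cases hx : x ∈ X
    · obtain ⟨n, hn⟩ := hU.exists_equation h hx
      exact ⟨n, fun _ => hn⟩
    · exact ⟨0, fun hx' => absurd hx' hx⟩
  choose n hn using h1
  refine ⟨closingMap R g v w c, n, fun u hu => h.map_unit hu, fun p hp q hq => h.map_inj hp hq,
    fun p hp q hq => h.map_adj hp hq, hn, fun T hT hT3 hTn x hx y hy u hu hxu => ?_⟩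
  exact hU.adj_of_equation h hT hT3 (n := n x) (fun z hz u hu hzu => by
    rw [hTn x hx z hz]; exact hn z (hT hz) u hu hzu) hx hy hu hxu

end IsSpherePart
end SphereFibre

/-! ### The obstruction `K₃,₃` -/

section Obstruction
open Matrix

/-- Vectors parallel to a common nonzero vector are parallel. -/
lemma cross_eq_zero_of_parallel {m p q : Fin 3 → ℝ} (hm : m ≠ 0) (hp : m ⨯₃ p = 0)
    (hq : m ⨯₃ q = 0) : p ⨯₃ q = 0 := by
  obtain ⟨r, hr, hu⟩ := exists_smul_unit hm
  have h1 := eq_smul_of_cross_eq_zero (K := p) hu (by simp [hp])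
  have h2 := eq_smul_of_cross_eq_zero (K := q) hu (by simp [hq])
  rw [h1, h2]
  simp

/-- Three distinct points of a unit sphere are not collinear. -/
lemma cross_sub_sub_ne_zero {a₀ a₁ a₂ b : Fin 3 → ℝ} (h₀ : (a₀ - b) ⬝ᵥ (a₀ - b) = 1)
    (h₁ : (a₁ - b) ⬝ᵥ (a₁ - b) = 1) (h₂ : (a₂ - b) ⬝ᵥ (a₂ - b) = 1) (h₀₁ : a₀ ≠ a₁) (h₀₂ : a₀ ≠ a₂)
    (h₁₂ : a₁ ≠ a₂) : (a₁ - a₀) ⨯₃ (a₂ - a₀) ≠ 0 := by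
  intro hc
  obtain ⟨r, hr, hu⟩ := exists_smul_unit (sub_ne_zero.2 h₀₁.symm)
  have h := eq_smul_of_cross_eq_zero (K := a₂ - a₀) hu
    (by rw [map_smul, LinearMap.smul_apply, hc, smul_zero])
  rw [smul_smul] at h
  generalize ((r • (a₁ - a₀)) ⬝ᵥ (a₂ - a₀)) * r = t at h
  have hpos := dot_self_pos3 (sub_ne_zero.2 h₀₁.symm)
  have e₁ : a₁ - b = (a₁ - a₀) + (a₀ - b) := by abel
  have e₂ : a₂ - b = t • (a₁ - a₀) + (a₀ - b) := by rw [← h]; abel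
  rw [e₁] at h₁
  rw [e₂] at h₂
  simp only [add_dotProduct, dotProduct_add, smul_dotProduct, dotProduct_smul, smul_eq_mul, h₀,
    dotProduct_comm (a₀ - b) (a₁ - a₀)] at h₁ h₂
  have h3 : t * (t - 1) * ((a₁ - a₀) ⬝ᵥ (a₁ - a₀)) = 0 := by linear_combination h₂ - t * h₁
  rcases mul_eq_zero.1 ((mul_eq_zero.1 h3).resolve_right hpos.ne') with ht | ht
  · rw [ht, zero_smul, sub_eq_zero] at h
    exact h₀₂ h.symm
  · rw [sub_eq_zero.1 ht, one_smul, sub_left_inj] at h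
    exact h₁₂ h.symm

/-- `K₃,₃` is not a unit distance graph in space: each of its sides would consist of three points on
a sphere, which are not collinear, so the two sides would span two planes all of whose directions
are orthogonal to each other. -/
lemma not_isUnitDistanceGraph_of_isContained {V : Type*} {G : SimpleGraph V}
    (hG : (completeBipartiteGraph (Fin 3) (Fin 3)).IsContained G) : ¬ IsUnitDistanceGraph G 3 := by
  rintro ⟨f, hf, hd⟩
  obtain ⟨φ⟩ := hG
  obtain ⟨a, ha⟩ : ∃ a : Fin 3 → Fin 3 → ℝ, ∀ i, a i = f (φ (Sum.inl i)) := ⟨_, fun _ => rfl⟩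
  obtain ⟨b, hb⟩ : ∃ b : Fin 3 → Fin 3 → ℝ, ∀ i, b i = f (φ (Sum.inr i)) := ⟨_, fun _ => rfl⟩
  have hab : ∀ i j, (a i - b j) ⬝ᵥ (a i - b j) = 1 := by
    intro i j
    have h1 := hd (φ (Sum.inl i)) (φ (Sum.inr j)) (φ.toHom.map_adj (by simp))
    rw [EuclideanSpace.dist_eq, Real.sqrt_eq_one, Fin.sum_univ_three] at h1
    simp only [Real.dist_eq, sq_abs] at h1
    rw [ha, hb, dot3]
    simp only [Pi.sub_apply]
    linarith
  have hba : ∀ i j, (b j - a i) ⬝ᵥ (b j - a i) = 1 := fun i j => by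
    rw [← neg_sub, neg_dotProduct, dotProduct_neg, neg_neg, hab]
  have inja : ∀ i j, i ≠ j → a i ≠ a j := fun i j hij h => by
    rw [ha, ha] at h
    exact hij (by simpa using φ.injective (hf (WithLp.ofLp_injective 2 h)))
  have injb : ∀ i j, i ≠ j → b i ≠ b j := fun i j hij h => by
    rw [hb, hb] at h
    exact hij (by simpa using φ.injective (hf (WithLp.ofLp_injective 2 h)))
  have horth : ∀ i j, (a i - a 0) ⬝ᵥ (b j - b 0) = 0 := by
    intro i j
    have h1 := hab i j
    have h2 := hab i 0
    have h3 := hab 0 j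
    have h4 := hab 0 0
    simp only [dot3, Pi.sub_apply] at *
    linarith
  have ha' := cross_sub_sub_ne_zero (hab 0 0) (hab 1 0) (hab 2 0) (inja 0 1 (by decide))
    (inja 0 2 (by decide)) (inja 1 2 (by decide))
  have hb' := cross_sub_sub_ne_zero (hba 0 0) (hba 0 1) (hba 0 2) (injb 0 1 (by decide))
    (injb 0 2 (by decide)) (injb 1 2 (by decide))
  have hpar : ∀ i, (b 1 - b 0) ⨯₃ (b 2 - b 0) ⨯₃ (a i - a 0) = 0 := fun i => by
    rw [cross_cross_eq_smul_sub_smul]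
    simp [dotProduct_comm _ (a i - a 0), horth]
  exact ha' (cross_eq_zero_of_parallel hb' (hpar 1) (hpar 2))

end Obstruction

/-! ### Placements of a single part -/

section Placement
open Finset
open scoped Classical RealInnerProductSpace

/-- The vectors `g u`, `u ∈ S`, are distinct unit vectors, orthogonal along the edges of `G`, and
the neighbours in `S` of each `x ∈ X` lie in the hyperplane `⟪n x, ·⟫ = 1`. -/
structure IsPlacement {V E : Type*} [NormedAddCommGroup E] [InnerProductSpace ℝ E]
    (G : SimpleGraph V) (S X : Finset V) (g n : V → E) : Prop where
  unit : ∀ u ∈ S, ‖g u‖ = 1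
  injOn : Set.InjOn g S
  adj : ∀ u ∈ S, ∀ v ∈ S, G.Adj u v → ⟪g u, g v⟫ = 0
  equation : ∀ x ∈ X, ∀ u ∈ S, G.Adj x u → ⟪n x, g u⟫ = 1

/-- No three elements of `X` have the same image. -/
def HasSmallFibres {V E : Type*} (X : Finset V) (n : V → E) : Prop :=
  ∀ x ∈ X, ∀ y ∈ X, ∀ z ∈ X, n x = n y → n y = n z → x = y ∨ y = z ∨ x = z

/-- A line meets the unit circle in at most two points. -/
lemma eq_or_eq_of_inner_eq_one {m p q r : EuclideanSpace ℝ (Fin 2)} (hp : ‖p‖ = 1) (hq : ‖q‖ = 1)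
    (hr : ‖r‖ = 1) (hmp : ⟪m, p⟫ = 1) (hmq : ⟪m, q⟫ = 1) (hmr : ⟪m, r⟫ = 1) :
    p = q ∨ r = p ∨ r = q := by
  -- a point `p` of the line is determined by the determinant `s p` of `m` and `p`
  let s : EuclideanSpace ℝ (Fin 2) → ℝ := fun p => m 0 * p 1 - m 1 * p 0
  have hm : ∀ p : EuclideanSpace ℝ (Fin 2), ⟪m, p⟫ = 1 → m 0 * p 0 + m 1 * p 1 = 1 := fun p h => by
    rw [PiLp.inner_apply, Fin.sum_univ_two] at h
    simp only [RCLike.inner_apply, conj_trivial] at h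
    linarith
  have hs : ∀ p : EuclideanSpace ℝ (Fin 2), ‖p‖ = 1 → ⟪m, p⟫ = 1 →
      s p ^ 2 = m 0 ^ 2 + m 1 ^ 2 - 1 := by
    intro p h1 h2
    have h3 : p 0 ^ 2 + p 1 ^ 2 = 1 := by
      have := EuclideanSpace.real_norm_sq_eq p
      rw [h1, Fin.sum_univ_two] at this
      linarith
    have h4 := hm p h2
    simp only [s]
    linear_combination (m 0 ^ 2 + m 1 ^ 2) * h3 - (m 0 * p 0 + m 1 * p 1 + 1) * h4
  have hinj : ∀ p q : EuclideanSpace ℝ (Fin 2), ⟪m, p⟫ = 1 → ⟪m, q⟫ = 1 → s p = s q → p = q := by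
    intro p q h1 h2 h3
    have h4 := hm p h1
    have h5 := hm q h2
    simp only [s] at h3
    have h6 : m 0 ^ 2 + m 1 ^ 2 ≠ 0 := fun h6 => by
      have h7 : m 0 = 0 := by nlinarith [sq_nonneg (m 0), sq_nonneg (m 1)]
      have h8 : m 1 = 0 := by nlinarith [sq_nonneg (m 0), sq_nonneg (m 1)]
      rw [h7, h8] at h4
      norm_num at h4
    ext i
    apply mul_left_cancel₀ h6
    fin_cases i
    · simp only [Fin.zero_eta]
      linear_combination m 0 * (h4 - h5) - m 1 * h3
    · simp only [Fin.mk_one]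
      linear_combination m 1 * (h4 - h5) + m 0 * h3
  have h1 := hs p hp hmp
  have h2 := hs q hq hmq
  have h3 := hs r hr hmr
  rcases sq_eq_sq_iff_eq_or_eq_neg.1 (h1.trans h2.symm) with h | h
  · exact Or.inl (hinj p q hmp hmq h)
  rcases sq_eq_sq_iff_eq_or_eq_neg.1 (h3.trans h1.symm) with h' | h'
  · exact Or.inr (Or.inl (hinj r p hmr hmp h'))
  · exact Or.inr (Or.inr (hinj r q hmr hmq (by linarith)))

variable {V : Type*} {G : SimpleGraph V} {S X : Finset V}

/-- A part of degree at most one can be placed on a circle: a matching is wrapped around the circle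
so that the unit distance becomes a right angle, and stays within an open half circle, which leaves
no opposite points. If three vertices of `X` had the same equation, they would have a common
neighbour, of too large degree. -/
lemma exists_isPlacement_circle [Fintype V] (hS : ∀ v ∈ S, G.degIn S v ≤ 1)
    (hSX : ∀ v ∈ S, G.degIn S v + G.degIn X v ≤ 2) (hX : ∀ x ∈ X, G.degIn S x = 2) :
    ∃ g n : V → EuclideanSpace ℝ (Fin 2), IsPlacement G S X g n ∧ HasSmallFibres X n := by
  obtain ⟨τ, hτ, hinj, hadj⟩ := exists_matching_line G S hS
  let g : V → EuclideanSpace ℝ (Fin 2) := fun v =>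
    !₂[Real.cos (Real.pi * τ v / 2), Real.sin (Real.pi * τ v / 2)]
  have hgg : ∀ u v, ⟪g u, g v⟫ = Real.cos (Real.pi * τ u / 2 - Real.pi * τ v / 2) := by
    intro u v
    rw [Real.cos_sub, PiLp.inner_apply, Fin.sum_univ_two]
    simp [g]
    ring
  have hg1 : ∀ u, ‖g u‖ = 1 := fun u => by
    have h1 := real_inner_self_eq_norm_sq (g u)
    rw [hgg, sub_self, Real.cos_zero] at h1
    have := norm_nonneg (g u)
    nlinarith
  have hpi := Real.pi_pos
  have hginj : Set.InjOn g S := by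
    intro u hu v hv huv
    apply hinj hu hv
    have h1 : Real.cos (Real.pi * τ u / 2) = Real.cos (Real.pi * τ v / 2) := by
      simpa [g] using congrArg (fun p : EuclideanSpace ℝ (Fin 2) => p 0) huv
    obtain ⟨h2, h3⟩ := hτ u hu
    obtain ⟨h4, h5⟩ := hτ v hv
    have h6 := Real.injOn_cos (x₁ := Real.pi * τ u / 2) (x₂ := Real.pi * τ v / 2)
      ⟨by positivity, by nlinarith⟩ ⟨by positivity, by nlinarith⟩ h1
    exact mul_left_cancel₀ hpi.ne' (by linarith)
  have hpos : ∀ u ∈ S, ∀ v ∈ S, 1 + ⟪g u, g v⟫ ≠ 0 := by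
    intro u hu v hv
    obtain ⟨h2, h3⟩ := hτ u hu
    obtain ⟨h4, h5⟩ := hτ v hv
    rw [hgg, ← Real.cos_abs]
    have h6 : |Real.pi * τ u / 2 - Real.pi * τ v / 2| < Real.pi := by
      rw [abs_lt]; constructor <;> nlinarith
    have := Real.cos_lt_cos_of_nonneg_of_le_pi (abs_nonneg _) le_rfl h6
    rw [Real.cos_pi] at this
    linarith
  have h1 : ∀ x, ∃ n : EuclideanSpace ℝ (Fin 2), x ∈ X → ∀ u ∈ S, G.Adj x u → ⟪n, g u⟫ = 1 := by
    intro x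
    by_cases hx : x ∈ X
    · obtain ⟨a, b, hab, hN⟩ := card_eq_two.1 (hX x hx)
      have hiff : ∀ u, (u ∈ S ∧ G.Adj x u) ↔ u = a ∨ u = b := fun u => by
        rw [← mem_filter, hN]; simp
      have ha := (hiff a).2 (by simp)
      have hb := (hiff b).2 (by simp)
      have h0 := hpos a ha.1 b hb.1
      refine ⟨(1 + ⟪g a, g b⟫)⁻¹ • (g a + g b), fun _ u hu hxu => ?_⟩
      rw [real_inner_smul_left, inner_add_left]
      rcases (hiff u).1 ⟨hu, hxu⟩ with rfl | rfl
      · rw [real_inner_self_eq_norm_sq, hg1, one_pow, real_inner_comm,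
          inv_mul_cancel₀ (hpos b hb.1 u hu)]
      · rw [real_inner_self_eq_norm_sq, hg1, one_pow, add_comm ⟪_, _⟫, inv_mul_cancel₀ h0]
    · exact ⟨0, fun hx' => absurd hx' hx⟩
  choose n hn using h1
  refine ⟨g, n, ⟨fun u _ => hg1 u, hginj, fun u hu v hv huv => ?_, hn⟩,
    fun x hx y hy z hz hxy hyz => ?_⟩
  · rw [hgg]
    rcases hadj u hu v hv huv with h | h
    · rw [h, show Real.pi * (τ v + 1) / 2 - Real.pi * τ v / 2 = Real.pi / 2 by ring,
        Real.cos_pi_div_two]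
    · rw [h, show Real.pi * τ u / 2 - Real.pi * (τ u + 1) / 2 = -(Real.pi / 2) by ring,
        Real.cos_neg, Real.cos_pi_div_two]
  · obtain ⟨a, b, hab, hN⟩ := card_eq_two.1 (hX x hx)
    have hmem : ∀ u, (u ∈ S ∧ G.Adj x u) ↔ u ∈ ({a, b} : Finset V) := fun u => by
      rw [← mem_filter, hN]
    have ha := (hmem a).2 (by simp)
    have hb := (hmem b).2 (by simp)
    -- equal normals force equal neighbourhoods
    have hsame : ∀ y ∈ X, n x = n y → G.Adj a y := by
      intro y hy hxy
      have hsub : {u ∈ S | G.Adj y u} ⊆ {a, b} := fun u hu => by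
        obtain ⟨huS, hyu⟩ := mem_filter.1 hu
        rcases eq_or_eq_of_inner_eq_one (hg1 a) (hg1 b) (hg1 u) (hn x hx a ha.1 ha.2)
          (hn x hx b hb.1 hb.2) (hxy ▸ hn y hy u huS hyu) with h | h | h
        · exact absurd (hginj ha.1 hb.1 h) hab
        · rw [hginj huS ha.1 h]; simp
        · rw [hginj huS hb.1 h]; simp
      have heq := eq_of_subset_of_card_le hsub ((card_pair hab).le.trans (hX y hy).symm.le)
      have : a ∈ ({u ∈ S | G.Adj y u} : Finset V) := by rw [heq]; simp
      exact (mem_filter.1 this).2.symm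
    by_contra! hne
    have h3 : ({x, y, z} : Finset V) ⊆ {w ∈ X | G.Adj a w} := by
      simp only [insert_subset_iff, singleton_subset_iff, mem_filter]
      exact ⟨⟨hx, ha.2.symm⟩, ⟨hy, hsame y hy hxy⟩, hz, hsame z hz (hxy.trans hyz)⟩
    have h4 := card_le_card h3
    rw [card_eq_three.2 ⟨x, y, z, hne.1, hne.2.2, hne.2.1, rfl⟩] at h4
    have h5 : 3 ≤ G.degIn X a := h4
    have h6 := hSX a ha.1
    omega

/-- Three vertices with three common neighbours span a `K₃,₃`. -/
lemma completeBipartiteGraph_isContained {T N : Finset V} (hT : #T = 3) (hN : #N = 3)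
    (h : ∀ x ∈ T, ∀ u ∈ N, G.Adj x u) :
    (completeBipartiteGraph (Fin 3) (Fin 3)).IsContained G := by
  let e := (T.equivFinOfCardEq hT).symm
  let e' := (N.equivFinOfCardEq hN).symm
  have hadj : ∀ i j, G.Adj (e i) (e' j) := fun i j => h _ (e i).2 _ (e' j).2
  refine ⟨⟨⟨Sum.elim (fun i => (e i : V)) fun i => (e' i : V), ?_⟩, ?_⟩⟩
  · rintro (i | i) (j | j) hij
    · simp at hij
    · exact hadj i j
    · exact (hadj j i).symm
    · simp at hij
  · rintro (i | i) (j | j) hij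
    · simpa [Subtype.ext_iff] using hij
    · exact absurd hij (hadj i j).ne
    · exact absurd hij (hadj j i).ne'
    · simpa [Subtype.ext_iff] using hij

/-- A part of degree at most two can be placed on a sphere; three vertices of `X` with the same
equation span a `K₃,₃` together with their common neighbours. -/
lemma IsSpherePart.exists_isPlacement [Finite V] (hU : IsSpherePart G S X) :
    ∃ g n : V → EuclideanSpace ℝ (Fin 3), IsPlacement G S X g n ∧
      (¬ (completeBipartiteGraph (Fin 3) (Fin 3)).IsContained G → HasSmallFibres X n) := by
  obtain ⟨g, n, h1, h2, h3, h4, h5⟩ := hU.exists_placement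
  have hin : ∀ a b : Fin 3 → ℝ, ⟪WithLp.toLp 2 a, WithLp.toLp 2 b⟫ = a ⬝ᵥ b := fun a b => by
    rw [EuclideanSpace.inner_toLp_toLp, star_trivial, dotProduct_comm]
  refine ⟨fun v => WithLp.toLp 2 (g v), fun v => WithLp.toLp 2 (n v), ⟨fun u hu => ?_,
    fun u hu v hv huv => h2 hu hv (WithLp.toLp_injective 2 huv), fun u hu v hv huv => ?_,
    fun x hx u hu hxu => ?_⟩, fun hK x hx y hy z hz hxy hyz => ?_⟩
  · have := real_inner_self_eq_norm_sq (WithLp.toLp 2 (g u))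
    rw [hin, h1 u hu] at this
    have := norm_nonneg (WithLp.toLp 2 (g u))
    nlinarith
  · rw [hin, h3 u hu v hv huv]
  · rw [hin, h4 x hx u hu hxu]
  · by_contra! hne
    have hxy' := WithLp.toLp_injective 2 hxy
    have hyz' := WithLp.toLp_injective 2 hyz
    have hT : #({x, y, z} : Finset V) = 3 :=
      card_eq_three.2 ⟨x, y, z, hne.1, hne.2.2, hne.2.1, rfl⟩
    refine hK (completeBipartiteGraph_isContained hT (hU.deg_eq x hx) fun w hw u hu => ?_)
    obtain ⟨huS, hxu⟩ := mem_filter.1 hu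
    refine h5 _ (by simp [insert_subset_iff, hx, hy, hz]) hT ?_ x (by simp) w hw u huS hxu
    simp [hxy', hyz']

end Placement

/-! ### Combining the parts -/

section Construction
open Finset
open scoped Classical RealInnerProductSpace

variable {V ι : Type*} [Fintype V] [Fintype ι] {G : SimpleGraph V} {κ : ι → ℕ}
  {s : V → Option ι}

/-- Placements of the parts in pairwise orthogonal spaces combine to a placement of the graph. -/
lemma isUnitDistanceGraph_of_isPlacement {g n : ∀ j, V → EuclideanSpace ℝ (Fin (κ j))}
    (h : ∀ j, IsPlacement G (partOf s (some j)) (partOf s none) (g j) (n j))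
    (hX : ∀ u ∈ partOf s none, ∀ v ∈ partOf s none, ¬ G.Adj u v)
    (hadj : ∀ x ∈ partOf s none, ∃ v ∉ partOf s none, G.Adj x v)
    {j₀ : ι} (hfib : HasSmallFibres (partOf s none) (n j₀)) :
    IsUnitDistanceGraph G (∑ j, κ j) := by
  let γ : V → PiLp 2 fun j => EuclideanSpace ℝ (Fin (κ j)) := fun v =>
    (s v).elim 0 fun j => PiLp.single 2 j (g j v)
  let ω : V → PiLp 2 fun j => EuclideanSpace ℝ (Fin (κ j)) := fun x => WithLp.toLp 2 fun j => n j x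
  have hγ : ∀ {v j}, s v = some j → γ v = PiLp.single 2 j (g j v) := fun hv => by
    simp only [γ, hv, Option.elim_some]
  have hsome : ∀ v ∉ partOf s none, ∃ j, s v = some j := fun v hv => by
    rw [mem_partOf] at hv
    exact Option.ne_none_iff_exists'.1 hv
  have hin : ∀ (w : PiLp 2 fun j => EuclideanSpace ℝ (Fin (κ j))) {v j}, s v = some j →
      ⟪w, γ v⟫ = ⟪w j, g j v⟫ := by
    intro w v j hv
    rw [hγ hv, PiLp.inner_apply, Finset.sum_eq_single j]
    · simp
    · intro i _ hij
      simp [Pi.single_eq_of_ne hij]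
    · simp
  have hw : ∀ x ∈ partOf s none, ∀ v ∉ partOf s none, G.Adj x v → ⟪ω x, γ v⟫ = 1 := by
    intro x hx v hv hxv
    obtain ⟨j, hj⟩ := hsome v hv
    rw [hin _ hj]
    exact (h j).equation x hx v (mem_partOf.2 hj) hxv
  have hnorm : ∀ v ∉ partOf s none, ‖γ v‖ = 1 := fun v hv => by
    obtain ⟨j, hj⟩ := hsome v hv
    rw [hγ hj, PiLp.norm_single]
    exact (h j).unit v (mem_partOf.2 hj)
  refine isUnitDistanceGraph_of_equations ?_ (partOf s none) γ ω hnorm ?_ ?_ hX ?_ hw ?_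
  · rw [(WithLp.linearEquiv 2 ℝ (∀ j, EuclideanSpace ℝ (Fin (κ j)))).finrank_eq,
      Module.finrank_pi_fintype]
    simp
  · intro u hu v hv huv
    obtain ⟨i, hi⟩ := hsome u hu
    obtain ⟨j, hj⟩ := hsome v hv
    have h0 : ⟪γ v, γ u⟫ = 1 := by rw [huv, real_inner_self_eq_norm_sq, hnorm v hv, one_pow]
    rw [hin _ hi, hγ hj] at h0
    by_cases hij : i = j
    · subst hij
      refine (h i).injOn (mem_partOf.2 hi) (mem_partOf.2 hj) ?_
      simpa [hγ hi, hγ hj] using congrArg (fun p => p i) huv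
    · simp [Pi.single_eq_of_ne hij] at h0
  · intro u hu v hv huv
    obtain ⟨i, hi⟩ := hsome u hu
    obtain ⟨j, hj⟩ := hsome v hv
    rw [hin _ hj, hγ hi]
    by_cases hij : j = i
    · subst hij
      simpa using (h j).adj u (mem_partOf.2 hi) v (mem_partOf.2 hj) huv
    · simp [Pi.single_eq_of_ne hij]
  · intro x hx h0
    obtain ⟨v, hv, hxv⟩ := hadj x hx
    have h1 := hw x hx v hv hxv
    rw [h0, inner_zero_left] at h1
    exact zero_ne_one h1
  · intro x hx y hy z hz hxy hyz
    exact hfib x hx y hy z hz (congrArg (fun p => p j₀) hxy) (congrArg (fun p => p j₀) hyz)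

/-- If the degrees are bounded by a sum of twos and threes, an optimal partition with these
capacities yields a placement. A single part `j₀` with small fibres is enough to separate the
vertices of the exceptional part. -/
lemma isUnitDistanceGraph_sum (hκ : ∀ j, κ j = 2 ∨ κ j = 3)
    (hd : ∀ v, G.degIn univ v ≤ ∑ j, κ j) (j₀ : ι)
    (hj₀ : κ j₀ = 3 → ¬ (completeBipartiteGraph (Fin 3) (Fin 3)).IsContained G) :
    IsUnitDistanceGraph G (∑ j, κ j) := by
  let k : Option ι → ℕ := fun q => q.elim 0 κ
  have hk : k none = 0 := rfl
  have hd' : ∀ v, G.degIn univ v ≤ ∑ q, k q := fun v => by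
    rw [Fintype.sum_option]
    simpa [k] using hd v
  obtain ⟨s, hs⟩ := exists_isOptimal G k
  have hpl : ∀ j (m : ℕ), k (some j) = m → m = 2 ∨ m = 3 →
      ∃ g n : V → EuclideanSpace ℝ (Fin m), IsPlacement G (partOf s (some j)) (partOf s none) g n ∧
        ((m = 3 → ¬ (completeBipartiteGraph (Fin 3) (Fin 3)).IsContained G) →
          HasSmallFibres (partOf s none) n) := by
    intro j m hm hm'
    have h1 : ∀ v ∈ partOf s (some j), G.degIn (partOf s (some j)) v < m := fun v hv =>
      hm ▸ hs.degIn_lt hk hd' (mem_partOf.1 hv)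
    have h2 : ∀ v ∈ partOf s (some j),
        G.degIn (partOf s (some j)) v + G.degIn (partOf s none) v ≤ m := fun v hv =>
      hm ▸ hs.degIn_add_le hk hd' (mem_partOf.1 hv)
    have h3 : ∀ x ∈ partOf s none, G.degIn (partOf s (some j)) x = m := fun x hx =>
      hm ▸ hs.degIn_none hk hd' (mem_partOf.1 hx) (some j)
    rcases hm' with rfl | rfl
    · obtain ⟨g, n, hg, hn⟩ := exists_isPlacement_circle
        (fun v hv => Nat.lt_succ_iff.1 (h1 v hv)) h2 h3
      exact ⟨g, n, hg, fun _ => hn⟩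
    · have hU : IsSpherePart G (partOf s (some j)) (partOf s none) :=
        { deg_le := fun v hv => Nat.lt_succ_iff.1 (h1 v hv)
          deg_add_le := h2
          deg_eq := h3
          disj := disjoint_left.2 fun v hv hv' => by
            rw [mem_partOf] at hv hv'
            simp [hv] at hv'
          exchange := fun D hD A hA hind hfull => hs.exchange hk hd' j D A
            (fun v hv => mem_partOf.1 (hD hv)) (fun v hv => mem_partOf.1 (hA hv)) hind
            (fun v hv => hm ▸ hfull v hv) }
      obtain ⟨g, n, hg, hn⟩ := hU.exists_isPlacement
      exact ⟨g, n, hg, fun hK => hn (hK rfl)⟩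
  choose g n hg hn using fun j => hpl j (κ j) rfl (hκ j)
  refine isUnitDistanceGraph_of_isPlacement hg (fun u hu v hv huv => ?_) (fun x hx => ?_)
    (hn j₀ hj₀)
  · have := hs.degIn_none hk hd' (mem_partOf.1 hu) none
    have h0 : 0 < G.degIn (partOf s none) u := degIn_pos_iff.2 ⟨v, hv, huv⟩
    omega
  · have h1 : G.degIn (partOf s (some j₀)) x = κ j₀ :=
      hs.degIn_none hk hd' (mem_partOf.1 hx) (some j₀)
    obtain ⟨v, hv, hxv⟩ := degIn_pos_iff.1
      (show 0 < G.degIn (partOf s (some j₀)) x by have := hκ j₀; omega)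
    refine ⟨v, fun hv' => ?_, hxv⟩
    rw [mem_partOf] at hv hv'
    simp [hv] at hv'

lemma isUnitDistanceGraph_one (h : ∀ v, G.degIn univ v ≤ 1) : IsUnitDistanceGraph G 1 := by
  obtain ⟨τ, -, hinj, hadj⟩ := exists_matching_line G univ fun v _ => h v
  refine ⟨fun v => !₂[τ v], fun u v huv => ?_, fun u v huv => ?_⟩
  · refine hinj (mem_univ u) (mem_univ v) ?_
    simpa using congrArg (fun p : EuclideanSpace ℝ (Fin 1) => p 0) huv
  · rw [EuclideanSpace.dist_eq]
    rcases hadj u (mem_univ u) v (mem_univ v) huv with h | h <;> simp [h]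

lemma isUnitDistanceGraph_of_degIn_le {d : ℕ} (hd : 1 ≤ d) (h : ∀ v, G.degIn univ v ≤ d)
    (hK : d = 3 → ¬ (completeBipartiteGraph (Fin 3) (Fin 3)).IsContained G) :
    IsUnitDistanceGraph G d := by
  obtain ⟨m, rfl | rfl⟩ := Nat.even_or_odd' d
  · have e : ∑ _ : Fin m, 2 = 2 * m := by simp [mul_comm]
    rw [← e] at h ⊢
    exact isUnitDistanceGraph_sum (fun _ => Or.inl rfl) h ⟨0, by omega⟩ (by simp)
  · rcases m with _ | m
    · exact isUnitDistanceGraph_one h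
    -- one part of dimension three, and `m` parts of dimension two
    have e : ∑ j : Option (Fin m), j.elim 3 (fun _ => 2) = 2 * (m + 1) + 1 := by
      simp [Fintype.sum_option]; ring
    rw [← e] at h ⊢
    have hκ : ∀ j : Option (Fin m), j.elim 3 (fun _ => 2) = 2 ∨ j.elim 3 (fun _ => 2) = 3 := by
      rintro (_ | j) <;> simp
    rcases m with _ | m
    · exact isUnitDistanceGraph_sum hκ h none fun _ => hK rfl
    · exact isUnitDistanceGraph_sum hκ h (some 0) (by simp)

end Construction

theorem theorem1 {V : Type*} [Fintype V] (G : SimpleGraph V) [DecidableRel G.Adj]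
    (d : ℕ) (hd : 1 ≤ d) (hG : G.maxDegree = d) :
    IsUnitDistanceGraph G d ↔
      ¬ (d = 3 ∧ (completeBipartiteGraph (Fin 3) (Fin 3)).IsContained G) := by
  constructor
  · rintro h ⟨rfl, hK⟩
    exact not_isUnitDistanceGraph_of_isContained hK h
  · intro h
    refine isUnitDistanceGraph_of_degIn_le hd (fun v => ?_) fun h3 hK => h ⟨h3, hK⟩
    rw [← hG]
    refine le_trans (le_of_eq ?_) (G.degree_le_maxDegree v)
    rw [SimpleGraph.degIn, ← G.card_neighborFinset_eq_degree]
    congr 1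
    ext w
    simp
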